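/- Let $X=(\Omega,\mathcal{F},\mu)$ be a probability space, let $n$ be a positive integer, and let $X^n$ carry the product $\sigma$-algebra and the product measure $\mu^n$. For a measurable function $f:X^n\to\{0,1\}$ let $$I_f:=\sum_{j=1}^n \Pr\left[f(x_1,\ldots,x_{j-1},x_j,x_{j+1},\ldots,x_n)\neq f(x_1,\ldots,x_{j-1},y_j,x_{j+1},\ldots,x_n)\right],$$ where $x_1,\ldots,x_n,y_1,\ldots,y_n$ are independent with law $\mu$, be the total influence of $f$. Let $\mathcal{J}=\{J_S\}_{S\subseteq[n]}$ be a collection of measurable functions $J_S:X^S\to\{0,1\}$. For $x\in X^n$ write $x_S=(x_i)_{i\in S}$, and put $$J_{\mathcal{J}}(x):=\bigcup_{S\subseteq[n],\ J_S(x_S)=1} S .$$ Let $\mathcal{F}_{\mathcal{J}}$ be the coarsest $\sigma$-algebra on $X^n$ that makes the map $x\mapsto (J_{\mathcal{J}}(x),x_{J_{\mathcal{J}}(x)})$, with values in the disjoint union $\bigsqcup_{S\subseteq[n]}X^S$, measurable. For a constant $k>0$, a $k$-pseudo-junta is a function $h:X^n\to\{0,1\}$ that is measurable with respect to $\mathcal{F}_{\mathcal{J}}$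 for some such $\mathcal{J}$ with $\int |J_{\mathcal{J}}(x)|\,d\mu^n(x)\le k$. Theorem. Let $f:X^n\to\{0,1\}$ be measurable. For every $\epsilon>0$ there exists an $e^{10^{15}\epsilon^{-3}\lceil I_f\rceil^3}$-pseudo-junta $h:X^n\to\{0,1\}$ such that $\|f-h\|_1=\int |f-h|\,d\mu^n\le\epsilon$. -/

import Mathlib

open MeasureTheory

namespace PseudoJunta

variable {X : Type*} {n : ℕ}

/-- `f` takes only the values `0` and `1`. -/
def IsBoolean {α : Type*} (f : α → ℝ) : Prop :=
  ∀ x, f x = 0 ∨ f x = 1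

/-- The influence of the `j`-th variable on `f`: the probability that `f x ≠ f x'`, where
`x = (x₁, …, xₙ)` and `x'` is `x` with its `j`-th coordinate replaced by `y`, the points
`x₁, …, xₙ, y` being independent with law `μ`. -/
noncomputable def influence [MeasurableSpace X] (μ : Measure X) (f : (Fin n → X) → ℝ)
    (j : Fin n) : ℝ :=
  ((Measure.pi fun _ : Fin n => μ).prod μ).real
    {p : (Fin n → X) × X | f p.1 ≠ f (Function.update p.1 j p.2)}

/-- The total influence `I_f`. -/
noncomputable def totalInfluence [MeasurableSpace X] (μ : Measure X)
    (f : (Fin n → X) → ℝ) : ℝ :=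
  ∑ j, influence μ f j

/-- For a collection `J = (J_S)` of functions `J_S : X^S → {0,1}`, indexed by all `S ⊆ [n]`,
the union of the sets `S` with `J_S(x_S) = 1`. -/
def selected (J : (S : Finset (Fin n)) → (S → X) → Bool) (x : Fin n → X) : Finset (Fin n) :=
  (Finset.univ.filter fun S : Finset (Fin n) => J S (S.restrict x) = true).biUnion id

/-- The map `x ↦ (J(x), x_{J(x)})`, with values in the disjoint union of the `X^S`. -/
def reveal (J : (S : Finset (Fin n)) → (S → X) → Bool) (x : Fin n → X) :
    (S : Finset (Fin n)) × (S → X) :=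
  ⟨selected J x, (selected J x).restrict x⟩

/-- The coarsest σ-algebra on `X^n` that makes `x ↦ (J(x), x_{J(x)})` measurable. -/
@[reducible] def sigmaAlgebra [MeasurableSpace X] (J : (S : Finset (Fin n)) → (S → X) → Bool) :
    MeasurableSpace (Fin n → X) :=
  MeasurableSpace.comap (reveal J) inferInstance

/-- `h` is a `k`-pseudo-junta. -/
def IsPseudoJunta [MeasurableSpace X] (μ : Measure X) (k : ℝ) (h : (Fin n → X) → ℝ) : Prop :=
  IsBoolean h ∧
    ∃ J : (S : Finset (Fin n)) → (S → X) → Bool,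
      (∀ S, Measurable (J S)) ∧
      Measurable[sigmaAlgebra J] h ∧
      ∫⁻ x, ((selected J x).card : ENNReal) ∂(Measure.pi fun _ : Fin n => μ) ≤ ENNReal.ofReal k

end PseudoJunta

/-! Let F_S be the Efron–Stein components of f, and L = ⌈I_f⌉. Components of size above k ≈ 16 L/ε
have total energy at most I_f/(k+1), so only sets of size at most k matter. A coordinate i ∈ S is
exposed at x if some T ⊆ S has large conditional energy (at least δ) above T ∪ {i} given x_T; S is
covered if all its coordinates are exposed.

Uncovered components carry little energy (`sum_expect_not_covered_le`). Fix i, cut each F_S with S ∋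
i to the event that i is hidden in S, and let g be the sum of the pure projections of these pieces.
Their total energy a equals E[D_i g], where D_i = f - E[f | all coordinates but i] satisfies |D_i| ≤
1 and E|D_i| ≤ Inf_i. In place of hypercontractivity, which fails on general product spaces,
`expect_pow_four_le` bounds the fourth moment by conditional second moments; hiddenness makes these
of order δ, so E g⁴ ≤ 2^(11k) δ a. Splitting E[D_i g] according to the size of g gives a ≤ 2 l Inf_i
for a small l.

Few sets are covered on average (`sum_expect_covered_le`). A covered set is a union of at most k
heavy sets, and by Bessel's inequality few sets above a given R are heavy, even conditionally on
x_R.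

Cutting F_S to the covered event creates components at smaller sets. The recursion `kept` corrects
these from large sets to small ones, and also reveals S when its correction is large. By
`sum_comp_eq_kept_add_lost` the low-degree part of f is then, up to a constant, the sum of the kept
parts plus orthogonal pieces of small norm. A level of the recursion multiplies the mass by
2^(O(k)), so the total mass and the expected number of revealed sets are 2^(O(k²)). The kept sum is
read off from the revealed coordinates, and rounding it at 1/2 gives h
(`exists_pseudoJunta_of_kept`). -/

namespace PseudoJunta

set_option linter.unusedSectionVars false

/-! ### Bounded measurable functions and conditional expectation on coordinates. -/

section Framework

variable {ι X : Type*} [MeasurableSpace X]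

/-- The algebra of bounded measurable real functions on `X^ι`. -/
def bddMeas (ι X : Type*) [MeasurableSpace X] : Subalgebra ℝ ((ι → X) → ℝ) where
  carrier := {g | Measurable g ∧ ∃ C, ∀ x, |g x| ≤ C}
  mul_mem' := by
    rintro a b ⟨ha, A, hA⟩ ⟨hb, B, hB⟩
    refine ⟨ha.mul hb, A * B, fun x => ?_⟩
    rw [Pi.mul_apply, abs_mul]
    exact mul_le_mul (hA x) (hB x) (abs_nonneg _) ((abs_nonneg _).trans (hA x))
  add_mem' := by
    rintro a b ⟨ha, A, hA⟩ ⟨hb, B, hB⟩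
    exact ⟨ha.add hb, A + B, fun x => (abs_add_le _ _).trans (add_le_add (hA x) (hB x))⟩
  algebraMap_mem' := fun r => ⟨measurable_const, |r|, fun _ => le_rfl⟩

/-- Bounded measurable real functions on `X^ι`. -/
abbrev Bdd (ι X : Type*) [MeasurableSpace X] : Type _ := bddMeas ι X

instance : CoeFun (Bdd ι X) fun _ => (ι → X) → ℝ := ⟨Subtype.val⟩

namespace Bdd

theorem measurable (g : Bdd ι X) : Measurable (g : (ι → X) → ℝ) := g.2.1

theorem exists_bound (g : Bdd ι X) : ∃ C, ∀ x, |g x| ≤ C := g.2.2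

@[ext] theorem ext {g h : Bdd ι X} (H : ∀ x, g x = h x) : g = h := Subtype.ext (funext H)

@[simp] theorem add_apply (g h : Bdd ι X) (x : ι → X) : (g + h : Bdd ι X) x = g x + h x := rfl
@[simp] theorem sub_apply (g h : Bdd ι X) (x : ι → X) : (g - h : Bdd ι X) x = g x - h x := rfl
@[simp] theorem mul_apply (g h : Bdd ι X) (x : ι → X) : (g * h : Bdd ι X) x = g x * h x := rfl
@[simp] theorem neg_apply (g : Bdd ι X) (x : ι → X) : (-g : Bdd ι X) x = -g x := rfl
@[simp] theorem smul_apply (c : ℝ) (g : Bdd ι X) (x : ι → X) :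
    (c • g : Bdd ι X) x = c * g x := rfl
@[simp] theorem zero_apply (x : ι → X) : (0 : Bdd ι X) x = 0 := rfl
@[simp] theorem one_apply (x : ι → X) : (1 : Bdd ι X) x = 1 := rfl
@[simp] theorem pow_apply (g : Bdd ι X) (n : ℕ) (x : ι → X) : (g ^ n : Bdd ι X) x = g x ^ n := rfl

@[simp] theorem sum_apply {α : Type*} (s : Finset α) (g : α → Bdd ι X) (x : ι → X) :
    (∑ a ∈ s, g a : Bdd ι X) x = ∑ a ∈ s, g a x :=
  map_sum ((Pi.evalAlgHom ℝ (fun _ : ι → X => ℝ) x).comp (bddMeas ι X).val) g s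

/-- The absolute value of a bounded measurable function. -/
noncomputable def abs (g : Bdd ι X) : Bdd ι X :=
  ⟨fun x => |g x|, g.measurable.abs, by
    obtain ⟨C, hC⟩ := g.exists_bound
    exact ⟨C, fun x => by rw [abs_abs]; exact hC x⟩⟩

@[simp] theorem abs_apply (g : Bdd ι X) (x : ι → X) : g.abs x = |g x| := rfl

open Classical in
/-- The indicator function of a measurable event. -/
noncomputable def ind (p : (ι → X) → Prop) (hp : MeasurableSet {x | p x}) : Bdd ι X :=
  ⟨fun x => if p x then 1 else 0, Measurable.ite hp measurable_const measurable_const,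
    1, fun x => by dsimp only; split_ifs <;> simp⟩

open Classical in
theorem ind_apply (p : (ι → X) → Prop) (hp : MeasurableSet {x | p x}) (x : ι → X) :
    ind p hp x = if p x then 1 else 0 := rfl

theorem ind_of {p : (ι → X) → Prop} (hp : MeasurableSet {x | p x}) {x : ι → X} (h : p x) :
    ind p hp x = 1 := by simp [ind_apply, h]

theorem ind_of_not {p : (ι → X) → Prop} (hp : MeasurableSet {x | p x}) {x : ι → X} (h : ¬ p x) :
    ind p hp x = 0 := by simp [ind_apply, h]

theorem ind_nonneg (p : (ι → X) → Prop) (hp : MeasurableSet {x | p x}) (x : ι → X) :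
    0 ≤ ind p hp x := by rw [ind_apply]; split_ifs <;> norm_num

end Bdd

theorem Bdd.integrable (g : Bdd ι X) (ν : Measure (ι → X)) [IsFiniteMeasure ν] :
    Integrable (g : (ι → X) → ℝ) ν := by
  obtain ⟨C, hC⟩ := g.exists_bound
  exact Integrable.of_bound g.measurable.aestronglyMeasurable C (ae_of_all _ hC)

variable [Fintype ι] [DecidableEq ι] (μ : Measure X) [IsProbabilityMeasure μ]

theorem measurable_finset_piecewise (R : Finset ι) :
    Measurable fun p : (ι → X) × (ι → X) => R.piecewise p.1 p.2 := by
  refine measurable_pi_lambda _ fun i => ?_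
  by_cases h : i ∈ R
  · simp only [h, Finset.piecewise_eq_of_mem]; fun_prop
  · simp only [h, not_false_eq_true, Finset.piecewise_eq_of_notMem]; fun_prop

theorem measurable_finset_piecewise_right (R : Finset ι) (x : ι → X) :
    Measurable fun y : ι → X => R.piecewise x y :=
  (measurable_finset_piecewise R).comp (measurable_const.prodMk measurable_id)

/-- Gluing the coordinates in `R` of one sample with the other coordinates of an independent
sample gives again a sample. -/
theorem measurePreserving_piecewise (R : Finset ι) :
    MeasurePreserving (fun p : (ι → X) × (ι → X) => R.piecewise p.1 p.2)
      ((Measure.pi fun _ : ι => μ).prod (Measure.pi fun _ : ι => μ))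
      (Measure.pi fun _ : ι => μ) := by
  refine ⟨measurable_finset_piecewise R, (Measure.pi_eq fun s hs => ?_).symm⟩
  rw [Measure.map_apply (measurable_finset_piecewise R) (MeasurableSet.univ_pi hs)]
  have : (fun p : (ι → X) × (ι → X) => R.piecewise p.1 p.2) ⁻¹' (Set.univ.pi s)
      = (Set.univ.pi fun i => if i ∈ R then s i else Set.univ) ×ˢ
        (Set.univ.pi fun i => if i ∈ R then Set.univ else s i) := by
    ext p
    simp only [Set.mem_preimage, Set.mem_pi, Set.mem_univ, true_imp_iff, Set.mem_prod,
      ← forall_and]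
    refine forall_congr' fun i => ?_
    by_cases h : i ∈ R <;> simp [h]
  rw [this, Measure.prod_prod, Measure.pi_pi, Measure.pi_pi, ← Finset.prod_mul_distrib]
  refine Finset.prod_congr rfl fun i _ => ?_
  by_cases h : i ∈ R <;> simp [h]

/-- The expectation of a bounded measurable function. -/
noncomputable def expect : Bdd ι X →ₗ[ℝ] ℝ where
  toFun g := ∫ x, g x ∂(Measure.pi fun _ : ι => μ)
  map_add' g h := integral_add (g.integrable _) (h.integrable _)
  map_smul' c _ := integral_const_mul c _

theorem expect_apply (g : Bdd ι X) : expect μ g = ∫ x, g x ∂(Measure.pi fun _ : ι => μ) := rfl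

/-- `g` with the coordinates in `R` frozen. -/
def Bdd.freeze (g : Bdd ι X) (R : Finset ι) (x : ι → X) : Bdd ι X :=
  ⟨fun y => g (R.piecewise x y), g.measurable.comp (measurable_finset_piecewise_right R x), by
    obtain ⟨C, hC⟩ := g.exists_bound
    exact ⟨C, fun y => hC _⟩⟩

/-- The conditional expectation given the coordinates in `R`. -/
noncomputable def condE (R : Finset ι) : Bdd ι X →ₗ[ℝ] Bdd ι X where
  toFun g := ⟨fun x => expect μ (g.freeze R x), by
    have : Measurable (Function.uncurry fun x y : ι → X => g (R.piecewise x y)) :=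
      g.measurable.comp (measurable_finset_piecewise R)
    exact this.stronglyMeasurable.integral_prod_right'.measurable, by
    obtain ⟨C, hC⟩ := g.exists_bound
    refine ⟨C, fun x => ?_⟩
    dsimp only
    rw [expect_apply, ← Real.norm_eq_abs]
    refine (norm_integral_le_of_norm_le_const (C := C) (ae_of_all _ fun y => ?_)).trans ?_
    · exact hC _
    · simp⟩
  map_add' g h := Bdd.ext fun x => (expect μ).map_add (g.freeze R x) (h.freeze R x)
  map_smul' c g := Bdd.ext fun x => (expect μ).map_smul c (g.freeze R x)

theorem condE_apply (R : Finset ι) (g : Bdd ι X) (x : ι → X) :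
    condE μ R g x = expect μ (g.freeze R x) := rfl

theorem condE_apply_integral (R : Finset ι) (g : Bdd ι X) (x : ι → X) :
    condE μ R g x = ∫ y, g (R.piecewise x y) ∂(Measure.pi fun _ : ι => μ) := rfl

variable {μ}

theorem expect_nonneg {g : Bdd ι X} (hg : ∀ x, 0 ≤ g x) : 0 ≤ expect μ g :=
  integral_nonneg hg

theorem expect_mono {g h : Bdd ι X} (H : ∀ x, g x ≤ h x) : expect μ g ≤ expect μ h :=
  integral_mono (g.integrable _) (h.integrable _) H

theorem expect_one : expect μ (1 : Bdd ι X) = 1 := by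
  simp [expect_apply]

theorem condE_nonneg {R : Finset ι} {g : Bdd ι X} (hg : ∀ x, 0 ≤ g x) (x : ι → X) :
    0 ≤ condE μ R g x := expect_nonneg fun _ => hg _

theorem condE_mono {R : Finset ι} {g h : Bdd ι X} (H : ∀ x, g x ≤ h x) (x : ι → X) :
    condE μ R g x ≤ condE μ R h x := expect_mono fun _ => H _

theorem condE_one (R : Finset ι) : condE μ R (1 : Bdd ι X) = 1 :=
  Bdd.ext fun _ => expect_one (μ := μ) (ι := ι) (X := X)

theorem abs_condE_le (R : Finset ι) (g : Bdd ι X) (x : ι → X) :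
    |condE μ R g x| ≤ condE μ R g.abs x := by
  simp only [condE_apply_integral]
  exact abs_integral_le_integral_abs

theorem sq_expect_le (g : Bdd ι X) : expect μ g ^ 2 ≤ expect μ (g ^ 2) := by
  have h : 0 ≤ expect μ ((g - expect μ g • 1) ^ 2) := expect_nonneg fun x => sq_nonneg _
  have e : (g - expect μ g • 1) ^ 2
      = g ^ 2 - (2 * expect μ g) • g + (expect μ g) ^ 2 • (1 : Bdd ι X) := by
    ext x; simp; ring
  rw [e, map_add, map_sub, map_smul, map_smul, expect_one] at h
  simp only [smul_eq_mul] at h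
  nlinarith

theorem sq_condE_le (R : Finset ι) (g : Bdd ι X) (x : ι → X) :
    condE μ R g x ^ 2 ≤ condE μ R (g ^ 2) x := sq_expect_le _

theorem condE_le_const {R : Finset ι} {g : Bdd ι X} {c : ℝ} (H : ∀ x, g x ≤ c) (x : ι → X) :
    condE μ R g x ≤ c := by
  have := condE_mono (μ := μ) (R := R) (g := g) (h := c • 1) (by simpa using H) x
  rw [map_smul, condE_one] at this
  simpa using this

theorem expect_condE (R : Finset ι) (g : Bdd ι X) : expect μ (condE μ R g) = expect μ g := by
  have h := (measurePreserving_piecewise (ι := ι) μ R)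
  have hi : Integrable (fun p : (ι → X) × (ι → X) => g (R.piecewise p.1 p.2))
      ((Measure.pi fun _ : ι => μ).prod (Measure.pi fun _ : ι => μ)) :=
    (h.integrable_comp g.measurable.aestronglyMeasurable).2 (g.integrable _)
  rw [expect_apply, expect_apply]
  simp only [condE_apply_integral]
  rw [integral_integral hi, ← integral_map (f := (g : (ι → X) → ℝ)) h.measurable.aemeasurable
    g.measurable.aestronglyMeasurable, h.map_eq]

/-- The coordinates outside `R ∩ S` get resampled once or twice; by independence this makes no
difference. -/
theorem condE_condE (R S : Finset ι) (g : Bdd ι X) :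
    condE μ R (condE μ S g) = condE μ (R ∩ S) g := by
  ext x
  rw [condE_apply μ (R ∩ S), ← expect_condE S]
  rw [condE_apply, expect_apply, expect_apply]
  refine integral_congr_ae (ae_of_all _ fun y => ?_)
  refine integral_congr_ae (ae_of_all _ fun z => ?_)
  refine congrArg g.1 (funext fun i => ?_)
  by_cases hR : i ∈ R <;> by_cases hS : i ∈ S <;> simp [Finset.piecewise, hR, hS]

theorem dependsOn_condE (R : Finset ι) (g : Bdd ι X) :
    DependsOn (condE μ R g : (ι → X) → ℝ) (R : Set ι) := by
  intro x y h
  rw [condE_apply_integral, condE_apply_integral]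
  refine integral_congr_ae (ae_of_all _ fun z => congrArg g.1 (funext fun i => ?_))
  by_cases hR : i ∈ R
  · simpa [hR] using h i hR
  · simp [hR]

theorem condE_mul {R : Finset ι} {g : Bdd ι X} (hg : DependsOn (g : (ι → X) → ℝ) (R : Set ι))
    (h : Bdd ι X) : condE μ R (g * h) = g * condE μ R h := by
  ext x
  rw [Bdd.mul_apply, condE_apply_integral, condE_apply_integral, ← integral_const_mul]
  refine integral_congr_ae (ae_of_all _ fun y => ?_)
  simp only [Bdd.mul_apply]
  congr 1
  exact hg fun i hi => by simp [Finset.mem_coe.1 hi]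

theorem condE_of_dependsOn {R : Finset ι} {g : Bdd ι X}
    (hg : DependsOn (g : (ι → X) → ℝ) (R : Set ι)) : condE μ R g = g := by
  have := condE_mul (μ := μ) hg 1
  rwa [condE_one, mul_one] at this

theorem condE_univ (g : Bdd ι X) : condE μ Finset.univ g = g :=
  condE_of_dependsOn fun x y h => by
    exact congrArg g.1 (funext fun i => h i (by simp))

theorem condE_empty (g : Bdd ι X) : condE μ ∅ g = expect μ g • (1 : Bdd ι X) := by
  ext x
  rw [condE_apply_integral, Bdd.smul_apply, Bdd.one_apply, mul_one, expect_apply]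
  simp

theorem expect_mul_condE {R : Finset ι} {g : Bdd ι X}
    (hg : DependsOn (g : (ι → X) → ℝ) (R : Set ι)) (h : Bdd ι X) :
    expect μ (g * condE μ R h) = expect μ (g * h) := by
  rw [← condE_mul hg, expect_condE]

theorem condE_inter_of_dependsOn {R S : Finset ι} {g : Bdd ι X}
    (hg : DependsOn (g : (ι → X) → ℝ) (S : Set ι)) : condE μ (R ∩ S) g = condE μ R g := by
  rw [← condE_condE, condE_of_dependsOn hg]

theorem condE_sum_apply {α : Type*} (R : Finset ι) (s : Finset α) (g : α → Bdd ι X) (x : ι → X) :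
    condE μ R (∑ a ∈ s, g a) x = ∑ a ∈ s, condE μ R (g a) x := by
  rw [map_sum, Bdd.sum_apply]

end Framework

/-! ### The Efron–Stein decomposition. -/

section EfronStein

variable {ι X : Type*} [Fintype ι] [DecidableEq ι] [MeasurableSpace X]
variable {μ : Measure X} [IsProbabilityMeasure μ]

theorem dependsOn_mono {S R : Finset ι} (h : S ⊆ R) {g : (ι → X) → ℝ}
    (hg : DependsOn g (S : Set ι)) : DependsOn g (R : Set ι) :=
  fun _ _ H => hg fun i hi => H i (h hi)

theorem dependsOn_mul {S : Set ι} {g h : Bdd ι X} (hg : DependsOn (g : (ι → X) → ℝ) S)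
    (hh : DependsOn (h : (ι → X) → ℝ) S) : DependsOn (g * h : Bdd ι X).1 S := fun x y H => by
  rw [Bdd.mul_apply, Bdd.mul_apply, hg H, hh H]

theorem dependsOn_add {S : Set ι} {g h : Bdd ι X} (hg : DependsOn (g : (ι → X) → ℝ) S)
    (hh : DependsOn (h : (ι → X) → ℝ) S) : DependsOn (g + h : Bdd ι X).1 S := fun x y H => by
  rw [Bdd.add_apply, Bdd.add_apply, hg H, hh H]

theorem dependsOn_smul {S : Set ι} {g : Bdd ι X} (c : ℝ) (hg : DependsOn (g : (ι → X) → ℝ) S) :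
    DependsOn (c • g : Bdd ι X).1 S := fun x y H => by
  rw [Bdd.smul_apply, Bdd.smul_apply, hg H]

theorem dependsOn_sum {α : Type*} {S : Set ι} {s : Finset α} {g : α → Bdd ι X}
    (hg : ∀ a ∈ s, DependsOn (g a : (ι → X) → ℝ) S) :
    DependsOn (∑ a ∈ s, g a : Bdd ι X).1 S := fun x y H => by
  rw [Bdd.sum_apply, Bdd.sum_apply]
  exact Finset.sum_congr rfl fun a ha => hg a ha H

theorem dependsOn_ind {S : Set ι} {p : (ι → X) → Prop} {hp : MeasurableSet {x | p x}}
    (h : DependsOn p S) : DependsOn (Bdd.ind p hp : (ι → X) → ℝ) S := fun x y H => by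
  classical
  simp only [Bdd.ind_apply, h H]

variable (μ) in
/-- The Efron–Stein component of `g` at the set `S` of coordinates. -/
noncomputable def comp (S : Finset ι) : Bdd ι X →ₗ[ℝ] Bdd ι X :=
  ∑ R ∈ S.powerset, (-1 : ℝ) ^ (S \ R).card • condE μ R

theorem comp_apply (S : Finset ι) (g : Bdd ι X) :
    comp μ S g = ∑ R ∈ S.powerset, (-1 : ℝ) ^ (S \ R).card • condE μ R g := by
  simp [comp, LinearMap.sum_apply]

variable (μ) in
/-- `G` depends only on the coordinates in `S` and averages to zero in each of them. -/
structure IsPure (S : Finset ι) (G : Bdd ι X) : Prop where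
  dependsOn : DependsOn (G : (ι → X) → ℝ) (S : Set ι)
  condE_eq_zero : ∀ R, ¬ S ⊆ R → condE μ R G = 0

/-- Once a coordinate `j ∈ S` is averaged out, the terms of the alternating sum at `U` and `insert j
U` agree up to sign and cancel in pairs. -/
theorem isPure_comp (S : Finset ι) (g : Bdd ι X) : IsPure μ S (comp μ S g) := by
  refine ⟨?_, fun R hR => ?_⟩
  · rw [comp_apply]
    exact dependsOn_sum fun R hR =>
      dependsOn_smul _ (dependsOn_mono (Finset.mem_powerset.1 hR) (dependsOn_condE R g))
  · obtain ⟨j, hjS, hjR⟩ := Finset.not_subset.1 hR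
    obtain ⟨S', hj, rfl⟩ : ∃ S', j ∉ S' ∧ insert j S' = S :=
      ⟨S.erase j, Finset.notMem_erase j S, Finset.insert_erase hjS⟩
    rw [comp_apply, map_sum, Finset.sum_powerset_insert hj, ← Finset.sum_add_distrib]
    refine Finset.sum_eq_zero fun U hU => ?_
    have hjU : j ∉ U := fun h => hj (Finset.mem_powerset.1 hU h)
    have h1 : (insert j S' \ U).card = (S' \ U).card + 1 := by
      rw [Finset.insert_sdiff_of_notMem _ hjU, Finset.card_insert_of_notMem (by simp [hj])]
    have h2 : insert j S' \ insert j U = S' \ U := by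
      ext i; simp only [Finset.mem_sdiff, Finset.mem_insert]
      by_cases h : i = j
      · subst h; simp [hj]
      · simp [h]
    have h3 : R ∩ insert j U = R ∩ U := by
      rw [Finset.inter_insert_of_notMem hjR]
    rw [map_smul, map_smul, condE_condE, condE_condE, h1, h2, h3, pow_succ]
    simp

theorem IsPure.smul {S : Finset ι} {G : Bdd ι X} (c : ℝ) (hG : IsPure μ S G) :
    IsPure μ S (c • G) :=
  ⟨dependsOn_smul c hG.1, fun R hR => by rw [map_smul, hG.2 R hR, smul_zero]⟩

theorem IsPure.sum {α : Type*} {S : Finset ι} {s : Finset α} {G : α → Bdd ι X}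
    (hG : ∀ a ∈ s, IsPure μ S (G a)) : IsPure μ S (∑ a ∈ s, G a) :=
  ⟨dependsOn_sum fun a ha => (hG a ha).1, fun R hR => by
    rw [map_sum]; exact Finset.sum_eq_zero fun a ha => (hG a ha).2 R hR⟩

theorem IsPure.condE_self {S R : Finset ι} {G : Bdd ι X} (hG : IsPure μ S G) (h : S ⊆ R) :
    condE μ R G = G := condE_of_dependsOn (dependsOn_mono h hG.1)

theorem IsPure.comp_self {S : Finset ι} {G : Bdd ι X} (hG : IsPure μ S G) :
    comp μ S G = G := by
  rw [comp_apply, Finset.sum_eq_single S]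
  · simp [hG.condE_self subset_rfl]
  · intro R hR hne
    rw [hG.2 R fun h => hne (subset_antisymm (Finset.mem_powerset.1 hR) h), smul_zero]
  · simp

/-- Products of pure functions at different sets average to zero, given any set of coordinates
that misses a coordinate of the first set outside the second. -/
theorem IsPure.condE_mul_eq_zero {S T R : Finset ι} {G H : Bdd ι X} (hG : IsPure μ S G)
    (hH : DependsOn (H : (ι → X) → ℝ) (T : Set ι)) {j : ι} (hjS : j ∈ S) (hjT : j ∉ T)
    (hjR : j ∉ R) : condE μ R (G * H) = 0 := by
  have hR : R ∩ Finset.univ.erase j = R := by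
    ext i; simp only [Finset.mem_inter, Finset.mem_erase, Finset.mem_univ, and_true]
    exact ⟨fun h => h.1, fun h => ⟨h, fun e => hjR (e ▸ h)⟩⟩
  have hT : T ⊆ Finset.univ.erase j := fun i hi => by
    simp only [Finset.mem_erase, Finset.mem_univ, and_true]; exact fun e => hjT (e ▸ hi)
  rw [← hR, ← condE_condE, mul_comm, condE_mul (dependsOn_mono hT hH),
    hG.2 _ (fun h => by simpa using h hjS), mul_zero, map_zero]

theorem expect_eq_of_condE {R : Finset ι} {g : Bdd ι X} (h : condE μ R g = 0) :
    expect μ g = 0 := by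
  rw [← expect_condE R, h, map_zero]

/-- A coordinate in the symmetric difference of `S` and `T` lies outside `R ⊆ S ∩ T`; only one of
the two factors sees it, and that factor averages to zero in it. -/
theorem condE_mul_eq_zero_of_ne {S T R : Finset ι} {G H : Bdd ι X} (hG : IsPure μ S G)
    (hH : IsPure μ T H) (hST : S ≠ T) (hRS : R ⊆ S) (hRT : R ⊆ T) :
    condE μ R (G * H) = 0 := by
  by_cases h : S ⊆ T
  · obtain ⟨j, hj, hj'⟩ := Finset.not_subset.1 fun h' => hST (subset_antisymm h h')
    rw [mul_comm]
    exact hH.condE_mul_eq_zero hG.1 hj hj' fun hjR => hj' (hRS hjR)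
  · obtain ⟨j, hj, hj'⟩ := Finset.not_subset.1 h
    exact hG.condE_mul_eq_zero hH.1 hj hj' fun hjR => hj' (hRT hjR)

theorem expect_mul_eq_zero_of_ne {S T : Finset ι} {G H : Bdd ι X} (hG : IsPure μ S G)
    (hH : IsPure μ T H) (hST : S ≠ T) : expect μ (G * H) = 0 :=
  expect_eq_of_condE (condE_mul_eq_zero_of_ne hG hH hST (Finset.empty_subset _)
    (Finset.empty_subset _))

/-- Conditional Pythagoras for a sum of pure functions. -/
theorem condE_sq_sum {𝒜 : Finset (Finset ι)} {R : Finset ι} {G : Finset ι → Bdd ι X}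
    (hG : ∀ S ∈ 𝒜, IsPure μ S (G S)) (hR : ∀ S ∈ 𝒜, R ⊆ S) :
    condE μ R ((∑ S ∈ 𝒜, G S) ^ 2) = ∑ S ∈ 𝒜, condE μ R (G S ^ 2) := by
  rw [sq, Finset.sum_mul_sum, map_sum]
  refine Finset.sum_congr rfl fun S hS => ?_
  rw [map_sum, Finset.sum_eq_single S]
  · rw [sq]
  · exact fun T hT hne => condE_mul_eq_zero_of_ne (hG S hS) (hG T hT) hne.symm (hR S hS) (hR T hT)
  · exact fun h => absurd hS h

theorem expect_sq_sum {𝒜 : Finset (Finset ι)} {G : Finset ι → Bdd ι X}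
    (hG : ∀ S ∈ 𝒜, IsPure μ S (G S)) :
    expect μ ((∑ S ∈ 𝒜, G S) ^ 2) = ∑ S ∈ 𝒜, expect μ (G S ^ 2) := by
  rw [← expect_condE ∅, condE_sq_sum hG fun S _ => Finset.empty_subset S, map_sum]
  simp only [expect_condE]

/-- Möbius inversion for the Efron–Stein decomposition. -/
theorem sum_comp_powerset (U : Finset ι) (g : Bdd ι X) :
    ∑ S ∈ U.powerset, comp μ S g = condE μ U g := by
  simp only [comp_apply]
  have : ∀ S ∈ U.powerset, ∑ R ∈ S.powerset, (-1 : ℝ) ^ (S \ R).card • condE μ R g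
      = ∑ R ∈ U.powerset, if R ⊆ S then (-1 : ℝ) ^ (S \ R).card • condE μ R g else 0 := by
    intro S hS
    rw [← Finset.sum_filter]
    refine Finset.sum_congr ?_ fun _ _ => rfl
    ext R
    simp only [Finset.mem_powerset, Finset.mem_filter]
    exact ⟨fun h => ⟨h.trans (Finset.mem_powerset.1 hS), h⟩, fun h => h.2⟩
  rw [Finset.sum_congr rfl this, Finset.sum_comm, Finset.sum_eq_single U]
  · rw [Finset.sum_eq_single U]
    · simp
    · intro S hS hne
      rw [if_neg fun h => hne (subset_antisymm (Finset.mem_powerset.1 hS) h)]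
    · simp
  · intro R hR hne
    rw [← Finset.sum_filter, ← Finset.sum_smul]
    have hRU := Finset.mem_powerset.1 hR
    have hne' : (U \ R).Nonempty := Finset.sdiff_nonempty.2 fun h => hne (subset_antisymm hRU h)
    have : ∑ S ∈ U.powerset with R ⊆ S, (-1 : ℝ) ^ (S \ R).card
        = ∑ W ∈ (U \ R).powerset, (-1 : ℝ) ^ W.card := by
      refine Finset.sum_bij' (fun S _ => S \ R) (fun W _ => W ∪ R) ?_ ?_ ?_ ?_ ?_
      · intro S hS
        simp only [Finset.mem_filter, Finset.mem_powerset] at hS ⊢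
        exact Finset.sdiff_subset_sdiff hS.1 subset_rfl
      · intro W hW
        simp only [Finset.mem_filter, Finset.mem_powerset] at hW ⊢
        exact ⟨Finset.union_subset (hW.trans Finset.sdiff_subset) hRU, Finset.subset_union_right⟩
      · intro S hS
        simp only [Finset.mem_filter, Finset.mem_powerset] at hS
        exact Finset.sdiff_union_of_subset hS.2
      · intro W hW
        simp only [Finset.mem_powerset] at hW
        rw [Finset.union_sdiff_right, Finset.sdiff_eq_self_iff_disjoint]
        exact Finset.disjoint_of_subset_left hW Finset.sdiff_disjoint
      · intro S _; rfl
    have h0 : ∑ W ∈ (U \ R).powerset, (-1 : ℝ) ^ W.card = 0 := by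
      have := Finset.sum_powerset_neg_one_pow_card_of_nonempty hne'
      exact_mod_cast this
    rw [this, h0, zero_smul]
  · simp

theorem sum_comp_univ (g : Bdd ι X) : ∑ S : Finset ι, comp μ S g = g := by
  rw [← Finset.powerset_univ, sum_comp_powerset, condE_univ]

theorem comp_empty (g : Bdd ι X) : comp μ ∅ g = expect μ g • (1 : Bdd ι X) := by
  rw [← condE_empty, ← sum_comp_powerset]; simp

theorem sum_comp_of_dependsOn {S : Finset ι} {g : Bdd ι X}
    (hg : DependsOn (g : (ι → X) → ℝ) (S : Set ι)) : ∑ R ∈ S.powerset, comp μ R g = g := by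
  rw [sum_comp_powerset, condE_of_dependsOn hg]

theorem IsPure.expect_mul_comp {S : Finset ι} {G : Bdd ι X} (hG : IsPure μ S G) (g : Bdd ι X) :
    expect μ (G * comp μ S g) = expect μ (G * g) := by
  conv_rhs => rw [← sum_comp_univ (μ := μ) g, Finset.mul_sum, map_sum]
  rw [Finset.sum_eq_single S]
  · exact fun T _ hne => expect_mul_eq_zero_of_ne hG (isPure_comp T g) hne.symm
  · simp

theorem expect_sq_comp_le (S : Finset ι) (g : Bdd ι X) :
    expect μ (comp μ S g ^ 2) ≤ expect μ (g ^ 2) := by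
  have h := (isPure_comp (μ := μ) S g).expect_mul_comp g
  have h2 : 0 ≤ expect μ ((g - comp μ S g) ^ 2) := expect_nonneg fun x => sq_nonneg _
  have e : (g - comp μ S g) ^ 2 = g ^ 2 - (2 : ℝ) • (comp μ S g * g) + comp μ S g ^ 2 := by
    ext x; simp; ring
  rw [e, map_add, map_sub, map_smul, smul_eq_mul, ← h, ← sq] at h2
  linarith

theorem abs_comp_le (S : Finset ι) (g : Bdd ι X) (x : ι → X) :
    |comp μ S g x| ≤ ∑ R ∈ S.powerset, condE μ R g.abs x := by
  rw [comp_apply, Bdd.sum_apply]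
  refine (Finset.abs_sum_le_sum_abs _ _).trans (Finset.sum_le_sum fun R _ => ?_)
  rw [Bdd.smul_apply, abs_mul, abs_pow, abs_neg, abs_one, one_pow, one_mul]
  exact abs_condE_le R g x

theorem expect_abs_comp_le (S : Finset ι) (g : Bdd ι X) :
    expect μ (comp μ S g).abs ≤ 2 ^ S.card * expect μ g.abs := by
  refine (expect_mono (h := ∑ R ∈ S.powerset, condE μ R g.abs) fun x => ?_).trans_eq ?_
  · rw [Bdd.sum_apply]; exact abs_comp_le S g x
  · rw [map_sum]
    simp [expect_condE]

/-- Cauchy–Schwarz over the `2 ^ S.card` terms of the alternating sum, then Jensen in each term. -/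
theorem sq_comp_le (S : Finset ι) (g : Bdd ι X) (x : ι → X) :
    comp μ S g x ^ 2 ≤ 2 ^ S.card * ∑ R ∈ S.powerset, condE μ R (g ^ 2) x := by
  rw [comp_apply, Bdd.sum_apply]
  refine sq_sum_le_card_mul_sum_sq.trans ?_
  rw [Finset.card_powerset, Nat.cast_pow, Nat.cast_ofNat]
  refine mul_le_mul_of_nonneg_left (Finset.sum_le_sum fun R _ => ?_) (by positivity)
  rw [Bdd.smul_apply, mul_pow, ← pow_mul, mul_comm _ 2, pow_mul]
  simpa using sq_condE_le R g x

end EfronStein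

/-! ### A fourth-moment inequality for sums of pure functions. -/

section FourthMoment

variable {ι X : Type*} [Fintype ι] [DecidableEq ι] [MeasurableSpace X]
variable {μ : Measure X} [IsProbabilityMeasure μ]

/-- The part of `∑ S, 2^{-|S|} G_S` over the sets with trace `B` on `A`, where the coordinates in
`A` are no longer damped. -/
noncomputable def tracePart (G : Finset ι → Bdd ι X) (A B : Finset ι) : Bdd ι X :=
  ∑ S with S ∩ A = B, ((1 / 2 : ℝ) ^ (S \ A).card) • G S

variable (μ) in
/-- The square function of the trace parts, with the coordinates in `A \ T` integrated out. -/
noncomputable def traceSq (G : Finset ι → Bdd ι X) (A T : Finset ι) : Bdd ι X :=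
  ∑ B ∈ A.powerset with T ⊆ B, condE μ (A \ T)ᶜ (tracePart G A B ^ 2)

/-- Sort the sets by whether they contain `n`; those that do release one damping factor when `n` is
undamped. -/
theorem tracePart_insert (G : Finset ι → Bdd ι X) {A B : Finset ι} {n : ι} (hn : n ∉ A)
    (hB : B ⊆ A) :
    tracePart G A B
      = tracePart G (insert n A) B + (1 / 2 : ℝ) • tracePart G (insert n A) (insert n B) := by
  have hnB : n ∉ B := fun h => hn (hB h)
  have key : (Finset.univ.filter fun S : Finset ι => S ∩ A = B)
      = (Finset.univ.filter fun S : Finset ι => S ∩ insert n A = B) ∪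
        (Finset.univ.filter fun S : Finset ι => S ∩ insert n A = insert n B) := by
    ext S
    simp only [Finset.mem_filter, Finset.mem_univ, true_and, Finset.mem_union]
    by_cases hS : n ∈ S
    · rw [Finset.inter_insert_of_mem hS]
      constructor
      · rintro rfl; exact Or.inr rfl
      · rintro (h | h)
        · exact absurd (h ▸ Finset.mem_insert_self _ _) hnB
        · have := congrArg (fun U => Finset.erase U n) h
          simpa [Finset.erase_insert, hn, hnB] using this
    · rw [Finset.inter_insert_of_notMem hS]
      constructor
      · exact Or.inl
      · rintro (h | h)
        · exact h
        · have : n ∈ S ∩ A := h ▸ Finset.mem_insert_self _ _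
          exact absurd (Finset.mem_inter.1 this).1 hS
  have hdisj : Disjoint (Finset.univ.filter fun S : Finset ι => S ∩ insert n A = B)
      (Finset.univ.filter fun S : Finset ι => S ∩ insert n A = insert n B) := by
    rw [Finset.disjoint_filter]
    intro S _ h h'
    exact hnB (h.symm.trans h' ▸ Finset.mem_insert_self _ _)
  rw [tracePart, key, Finset.sum_union hdisj, tracePart, tracePart, Finset.smul_sum]
  congr 1
  · refine Finset.sum_congr rfl fun S hS => ?_
    simp only [Finset.mem_filter, Finset.mem_univ, true_and] at hS
    have hnS : n ∉ S := fun h =>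
      hnB (hS ▸ Finset.mem_inter.2 ⟨h, Finset.mem_insert_self _ _⟩)
    rw [Finset.sdiff_insert_of_notMem hnS]
  · refine Finset.sum_congr rfl fun S hS => ?_
    simp only [Finset.mem_filter, Finset.mem_univ, true_and] at hS
    have hnS : n ∈ S := by
      have : n ∈ S ∩ insert n A := hS ▸ Finset.mem_insert_self _ _
      exact (Finset.mem_inter.1 this).1
    have : (S \ A).card = (S \ insert n A).card + 1 := by
      rw [Finset.sdiff_insert, Finset.card_erase_add_one (by simp [hnS, hn])]
    rw [this, smul_smul, pow_succ, mul_comm]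

/-- Together with `condE_tracePart`, this removes the cross term in `traceSq_step`. -/
theorem dependsOn_tracePart {G : Finset ι → Bdd ι X} (hG : ∀ S, IsPure μ S (G S))
    {A B : Finset ι} {n : ι} (hn : n ∈ A) (hB : n ∉ B) :
    DependsOn (tracePart G A B : (ι → X) → ℝ) ((Finset.univ.erase n : Finset ι) : Set ι) := by
  refine dependsOn_sum fun S hS => dependsOn_smul _ (dependsOn_mono ?_ (hG S).1)
  simp only [Finset.mem_filter, Finset.mem_univ, true_and] at hS
  intro i hi
  simp only [Finset.mem_erase, Finset.mem_univ, and_true]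
  rintro rfl
  exact hB (hS ▸ Finset.mem_inter.2 ⟨hi, hn⟩)

theorem condE_tracePart {G : Finset ι → Bdd ι X} (hG : ∀ S, IsPure μ S (G S))
    {A B : Finset ι} {n : ι} (hB : n ∈ B) :
    condE μ (Finset.univ.erase n) (tracePart G A B) = 0 := by
  rw [tracePart, map_sum]
  refine Finset.sum_eq_zero fun S hS => ?_
  simp only [Finset.mem_filter, Finset.mem_univ, true_and] at hS
  have hn : n ∈ S := (Finset.mem_inter.1 (hS ▸ hB : n ∈ S ∩ A)).1
  rw [map_smul, (hG S).2 _ (fun h => by simpa using h hn), smul_zero]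

/-- Cauchy–Schwarz for conditional expectations of finite sums. -/
theorem sq_sum_condE_mul_le {α : Type*} (s : Finset α) (R : Finset ι) (a b : α → Bdd ι X)
    (x : ι → X) :
    (∑ i ∈ s, condE μ R (a i * b i) x) ^ 2
      ≤ (∑ i ∈ s, condE μ R (a i ^ 2) x) * ∑ i ∈ s, condE μ R (b i ^ 2) x := by
  set p := ∑ i ∈ s, condE μ R (a i ^ 2) x
  set q := ∑ i ∈ s, condE μ R (a i * b i) x
  set r := ∑ i ∈ s, condE μ R (b i ^ 2) x
  have h : ∀ t : ℝ, 0 ≤ r * (t * t) + (2 * q) * t + p := by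
    intro t
    have h0 : 0 ≤ ∑ i ∈ s, condE μ R ((a i + t • b i) ^ 2) x :=
      Finset.sum_nonneg fun i _ => condE_nonneg (fun y => sq_nonneg _) x
    have e : ∀ i, (a i + t • b i) ^ 2 = a i ^ 2 + (2 * t) • (a i * b i) + (t * t) • b i ^ 2 := by
      intro i; ext y; simp; ring
    simp only [e, map_add, map_smul, Bdd.add_apply, Bdd.smul_apply, Finset.sum_add_distrib,
      ← Finset.mul_sum] at h0
    change 0 ≤ p + 2 * t * q + t * t * r at h0
    linarith
  have := discrim_le_zero h
  rw [discrim] at this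
  nlinarith

/-- Undamp the coordinate `n`: each trace part is `a + b/2`, with `a` free of `n` and `b` of mean
zero in `n`. With `p`, `q`, `r` the conditional sums of `a²`, `ab`, `b²`, the left side is the mean
of `(p + q + r/4)²`. Since `p` is free of `n`, `pq` has mean zero and `r` may be averaged over `n`
inside `pr`; completing the square leaves `(p + E_n r)²`, the term for `T`, and `r²`, the term for
`insert n T`. -/
theorem traceSq_step {G : Finset ι → Bdd ι X} (hG : ∀ S, IsPure μ S (G S)) {A T : Finset ι}
    {n : ι} (hn : n ∉ A) (hT : T ⊆ A) :
    expect μ (traceSq μ G A T ^ 2) ≤ expect μ (traceSq μ G (insert n A) T ^ 2)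
      + expect μ (traceSq μ G (insert n A) (insert n T) ^ 2) := by
  have hnT : n ∉ T := fun h => hn (hT h)
  set R : Finset ι := (A \ T)ᶜ with hR
  set E : Finset ι := Finset.univ.erase n with hE
  set s : Finset (Finset ι) := A.powerset.filter fun B => T ⊆ B with hs
  set a : Finset ι → Bdd ι X := fun B => tracePart G (insert n A) B with ha
  set b : Finset ι → Bdd ι X := fun B => tracePart G (insert n A) (insert n B) with hb
  set p : Bdd ι X := ∑ B ∈ s, condE μ R (a B ^ 2) with hp
  set q : Bdd ι X := ∑ B ∈ s, condE μ R (a B * b B) with hq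
  set r : Bdd ι X := ∑ B ∈ s, condE μ R (b B ^ 2) with hr
  have hBA : ∀ B ∈ s, B ⊆ A := fun B hB => Finset.mem_powerset.1 (Finset.mem_filter.1 hB).1
  have hRE : ∀ g : Bdd ι X, condE μ E (condE μ R g) = condE μ R (condE μ E g) := fun g => by
    rw [condE_condE, condE_condE, Finset.inter_comm]
  have haE : ∀ B ∈ s, DependsOn (a B : (ι → X) → ℝ) (E : Set ι) := fun B hB =>
    dependsOn_tracePart hG (Finset.mem_insert_self _ _) fun h => hn (hBA B hB h)
  have hbE : ∀ B, condE μ E (b B) = 0 := fun B => condE_tracePart hG (Finset.mem_insert_self _ _)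
  have hpE : condE μ E p = p := by
    rw [hp, map_sum]
    refine Finset.sum_congr rfl fun B hB => ?_
    rw [hRE, sq, condE_of_dependsOn (dependsOn_mul (haE B hB) (haE B hB))]
  have hpd : DependsOn (p : (ι → X) → ℝ) (E : Set ι) := by
    rw [← hpE]; exact dependsOn_condE _ _
  have hqE : condE μ E q = 0 := by
    rw [hq, map_sum]
    refine Finset.sum_eq_zero fun B hB => ?_
    rw [hRE, condE_mul (haE B hB), hbE, mul_zero, map_zero]
  have h1 : traceSq μ G A T = p + q + (1 / 4 : ℝ) • r := by
    rw [traceSq, hp, hq, hr, Finset.smul_sum, ← Finset.sum_add_distrib, ← Finset.sum_add_distrib]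
    refine Finset.sum_congr rfl fun B hB => ?_
    rw [tracePart_insert G hn (hBA B hB)]
    have : (tracePart G (insert n A) B + (1 / 2 : ℝ) • tracePart G (insert n A) (insert n B)) ^ 2
        = a B ^ 2 + a B * b B + (1 / 4 : ℝ) • b B ^ 2 := by
      ext x; simp [ha, hb]; ring
    rw [this, map_add, map_add, map_smul]
  have hfilt : ((insert n A).powerset.filter fun B => T ⊆ B) = s ∪ s.image (insert n) := by
    ext B
    simp only [hs, Finset.mem_filter, Finset.mem_powerset, Finset.mem_union, Finset.mem_image]
    constructor
    · rintro ⟨h, hTB⟩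
      by_cases hnB : n ∈ B
      · refine Or.inr ⟨B.erase n, ⟨?_, ?_⟩, Finset.insert_erase hnB⟩
        · exact fun i hi => (Finset.mem_insert.1 (h (Finset.mem_erase.1 hi).2)).resolve_left
            (Finset.mem_erase.1 hi).1
        · exact fun i hi => Finset.mem_erase.2 ⟨fun e => hnT (e ▸ hi), hTB hi⟩
      · exact Or.inl ⟨fun i hi => (Finset.mem_insert.1 (h hi)).resolve_left
          fun e => hnB (e ▸ hi), hTB⟩
    · rintro (⟨h, h'⟩ | ⟨C, ⟨h, h'⟩, rfl⟩)
      · exact ⟨h.trans (Finset.subset_insert _ _), h'⟩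
      · exact ⟨Finset.insert_subset_insert _ h, h'.trans (Finset.subset_insert _ _)⟩
  have hfilt' : ((insert n A).powerset.filter fun B => insert n T ⊆ B) = s.image (insert n) := by
    ext B
    have := congrArg (B ∈ ·) hfilt
    simp only [Finset.mem_filter, Finset.mem_powerset, Finset.mem_union, eq_iff_iff] at this
    simp only [Finset.mem_filter, Finset.mem_powerset, Finset.insert_subset_iff]
    constructor
    · rintro ⟨h, hnB, hTB⟩
      rcases this.1 ⟨h, hTB⟩ with h | h
      · exact absurd (hBA B h hnB) hn
      · exact h
    · intro h
      obtain ⟨h1, h2⟩ := this.2 (Or.inr h)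
      obtain ⟨C, _, rfl⟩ := Finset.mem_image.1 h
      exact ⟨h1, Finset.mem_insert_self _ _, h2⟩
  have hinj : Set.InjOn (insert n) (s : Set (Finset ι)) := by
    intro B hB C hC h
    have hB' : n ∉ B := fun h => hn (hBA B hB h)
    have hC' : n ∉ C := fun h => hn (hBA C hC h)
    rw [← Finset.erase_insert hB', ← Finset.erase_insert hC']
    exact congrArg (Finset.erase · n) h
  have hdisj : Disjoint s (s.image (insert n)) := by
    rw [Finset.disjoint_left]
    intro B hB h
    obtain ⟨C, _, rfl⟩ := Finset.mem_image.1 h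
    exact hn (hBA _ hB (Finset.mem_insert_self _ _))
  have hR2 : (insert n A \ insert n T)ᶜ = R := by
    rw [hR]; congr 1
    ext i; simp only [Finset.mem_sdiff, Finset.mem_insert]
    by_cases h : i = n
    · subst h; simp [hn]
    · simp [h]
  have hR1 : (insert n A \ T)ᶜ = E ∩ R := by
    rw [hR, hE]
    ext i; simp only [Finset.mem_compl, Finset.mem_sdiff, Finset.mem_insert, Finset.mem_inter,
      Finset.mem_erase, Finset.mem_univ, and_true]
    by_cases h : i = n
    · subst h; simp [hnT]
    · simp [h]
  have h2 : traceSq μ G (insert n A) T = p + condE μ E r := by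
    rw [traceSq, hfilt, Finset.sum_union hdisj, Finset.sum_image hinj, hR1]
    simp only [← condE_condE]
    rw [← map_sum (condE μ E), ← map_sum (condE μ E)]
    exact congrArg (· + condE μ E r) hpE
  have h3 : traceSq μ G (insert n A) (insert n T) = r := by
    rw [traceSq, hfilt', Finset.sum_image hinj, hR2]
  have hp0 : ∀ x, 0 ≤ p x := fun x => by
    rw [hp, Bdd.sum_apply]
    exact Finset.sum_nonneg fun B _ => condE_nonneg (fun y => sq_nonneg _) x
  have hr0 : ∀ x, 0 ≤ r x := fun x => by
    rw [hr, Bdd.sum_apply]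
    exact Finset.sum_nonneg fun B _ => condE_nonneg (fun y => sq_nonneg _) x
  have hcs : ∀ x, q x ^ 2 ≤ p x * r x := fun x => by
    rw [hp, hq, hr, Bdd.sum_apply, Bdd.sum_apply, Bdd.sum_apply]
    exact sq_sum_condE_mul_le s R a b x
  rw [h1, h2, h3]
  have hpq : expect μ (p * q) = 0 := by
    rw [← expect_mul_condE hpd, hqE, mul_zero, map_zero]
  have hpr : expect μ (p * r) = expect μ (p * condE μ E r) := (expect_mul_condE hpd r).symm
  calc expect μ ((p + q + (1 / 4 : ℝ) • r) ^ 2)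
      ≤ expect μ (p ^ 2 + (2 : ℝ) • (p * q) + (2 : ℝ) • (p * r) + r ^ 2) := by
        -- From `q² ≤ pr` and `qr/2 ≤ q²/2 + r²/8`; the damping factor 1/2 on `b` leaves the room
        -- that this needs.
        refine expect_mono fun x => ?_
        simp only [Bdd.pow_apply, Bdd.add_apply, Bdd.smul_apply, Bdd.mul_apply]
        nlinarith [hcs x, sq_nonneg (q x - r x / 2), sq_nonneg (r x)]
    _ = expect μ (p ^ 2 + (2 : ℝ) • (p * condE μ E r) + r ^ 2) := by
        simp only [map_add, map_smul, hpq, hpr, smul_zero, add_zero]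
    _ ≤ expect μ ((p + condE μ E r) ^ 2 + r ^ 2) := by
        refine expect_mono fun x => ?_
        simp only [Bdd.pow_apply, Bdd.add_apply, Bdd.smul_apply, Bdd.mul_apply]
        nlinarith [sq_nonneg (condE μ E r x)]
    _ = _ := map_add _ _ _

/-- Induction on `A`: at `A = ∅` the single term is the fourth moment itself, and each new
coordinate splits every term in two. -/
theorem expect_pow_four_le_traceSq {G : Finset ι → Bdd ι X} (hG : ∀ S, IsPure μ S (G S))
    (A : Finset ι) :
    expect μ ((∑ S, (1 / 2 : ℝ) ^ S.card • G S) ^ 4)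
      ≤ ∑ T ∈ A.powerset, expect μ (traceSq μ G A T ^ 2) := by
  induction A using Finset.induction_on with
  | empty =>
    have : traceSq μ G ∅ ∅ = (∑ S, (1 / 2 : ℝ) ^ S.card • G S) ^ 2 := by
      simp [traceSq, tracePart, condE_univ]
    rw [Finset.powerset_empty, Finset.sum_singleton, this, ← pow_mul]
  | insert n A hn ih =>
    refine ih.trans ?_
    rw [Finset.sum_powerset_insert hn, ← Finset.sum_add_distrib]
    exact Finset.sum_le_sum fun T hT => traceSq_step hG hn (Finset.mem_powerset.1 hT)

/-- The fourth moment of a damped sum of pure functions is controlled by its conditional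
second moments. -/
theorem expect_pow_four_damped_le {G : Finset ι → Bdd ι X} (hG : ∀ S, IsPure μ S (G S)) :
    expect μ ((∑ S, (1 / 2 : ℝ) ^ S.card • G S) ^ 4)
      ≤ ∑ T, expect μ ((∑ S with T ⊆ S, condE μ T (G S ^ 2)) ^ 2) := by
  refine (expect_pow_four_le_traceSq hG Finset.univ).trans_eq ?_
  rw [Finset.powerset_univ]
  refine Finset.sum_congr rfl fun T _ => ?_
  -- When every coordinate is undamped, only `B` itself has trace `B`.
  have : ∀ B, tracePart G Finset.univ B = G B := fun B => by
    simp [tracePart, Finset.filter_eq', Finset.sdiff_eq_empty_iff_subset.2 (Finset.subset_univ B)]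
  rw [traceSq, Finset.powerset_univ]
  simp only [this, ← Finset.compl_eq_univ_sdiff, compl_compl]

/-- The fourth moment of a sum of pure functions of degree at most `k`. -/
theorem expect_pow_four_le {G : Finset ι → Bdd ι X} (hG : ∀ S, IsPure μ S (G S)) (k : ℕ)
    (hk : ∀ S, k < S.card → G S = 0) :
    expect μ ((∑ S, G S) ^ 4)
      ≤ 16 ^ k * ∑ T, expect μ ((∑ S with T ⊆ S, condE μ T (G S ^ 2)) ^ 2) := by
  -- Cancelling the damping multiplies each second moment by `4 ^ S.card ≤ 4 ^ k`, hence the final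
  -- bound by `16 ^ k`.
  have h := expect_pow_four_damped_le (μ := μ) (G := fun S => (2 : ℝ) ^ S.card • G S)
    fun S => (hG S).smul _
  have e : ∀ S : Finset ι, (1 / 2 : ℝ) ^ S.card • ((2 : ℝ) ^ S.card • G S) = G S := fun S => by
    rw [smul_smul, ← mul_pow]; norm_num
  simp only [e] at h
  refine h.trans ?_
  rw [Finset.mul_sum]
  refine Finset.sum_le_sum fun T _ => ?_
  rw [← smul_eq_mul, ← map_smul]
  refine expect_mono fun x => ?_
  simp only [Bdd.pow_apply, Bdd.smul_apply, Bdd.sum_apply]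
  have h16 : (16 : ℝ) ^ k = (4 ^ k) ^ 2 := by rw [← pow_mul, mul_comm, pow_mul]; norm_num
  rw [h16, ← mul_pow]
  refine pow_le_pow_left₀ (Finset.sum_nonneg fun S _ => condE_nonneg (fun y => sq_nonneg _) x) ?_ 2
  rw [Finset.mul_sum]
  refine Finset.sum_le_sum fun S _ => ?_
  have e2 : ((2 : ℝ) ^ S.card • G S) ^ 2 = (4 : ℝ) ^ S.card • G S ^ 2 := by
    ext y; simp only [Bdd.pow_apply, Bdd.smul_apply, mul_pow, ← pow_mul, mul_comm _ 2]
    rw [pow_mul]; norm_num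
  rw [e2, map_smul, Bdd.smul_apply]
  by_cases hS : k < S.card
  · simp [hk S hS]
  · exact mul_le_mul_of_nonneg_right (pow_le_pow_right₀ (by norm_num) (not_lt.1 hS))
      (condE_nonneg (fun y => sq_nonneg _) x)

end FourthMoment

/-! ### Hidden coordinates and the energy of uncovered sets. -/

section Coverage

variable {ι X : Type*} [Fintype ι] [DecidableEq ι] [MeasurableSpace X]
variable {μ : Measure X} [IsProbabilityMeasure μ]

/-- The nonempty sets of at most `k` coordinates. -/
def lowSets (ι : Type*) [Fintype ι] [DecidableEq ι] (k : ℕ) : Finset (Finset ι) :=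
  Finset.univ.filter fun S => S.Nonempty ∧ S.card ≤ k

theorem mem_lowSets {k : ℕ} {S : Finset ι} : S ∈ lowSets ι k ↔ S.Nonempty ∧ S.card ≤ k := by
  simp [lowSets]

theorem lowSets_zero : lowSets ι 0 = ∅ := by
  ext S
  simp only [mem_lowSets, Finset.notMem_empty, iff_false, not_and, not_le]
  exact Finset.card_pos.2

variable (μ) in
/-- The energy of the components of `f` above `U`, given the coordinates in `T`. -/
noncomputable def energy (f : Bdd ι X) (k : ℕ) (T U : Finset ι) : Bdd ι X :=
  condE μ T (∑ S ∈ lowSets ι k with U ⊆ S, comp μ S f ^ 2)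

theorem dependsOn_energy (f : Bdd ι X) (k : ℕ) (T U : Finset ι) :
    DependsOn (energy μ f k T U : (ι → X) → ℝ) (T : Set ι) := dependsOn_condE _ _

theorem energy_nonneg (f : Bdd ι X) (k : ℕ) (T U : Finset ι) (x : ι → X) :
    0 ≤ energy μ f k T U x :=
  condE_nonneg (fun y => by
    rw [Bdd.sum_apply]; exact Finset.sum_nonneg fun S _ => sq_nonneg _) x

variable (μ) in
/-- No subset of `S` exposes the coordinate `i`. -/
def Hidden (f : Bdd ι X) (k : ℕ) (δ : ℝ) (i : ι) (S : Finset ι) (x : ι → X) : Prop :=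
  ∀ T, T ⊆ S → energy μ f k T (insert i T) x < δ

variable (μ) in
/-- Every coordinate in `S` is exposed by a subset of `S`. -/
def Covered (f : Bdd ι X) (k : ℕ) (δ : ℝ) (S : Finset ι) (x : ι → X) : Prop :=
  ∀ i ∈ S, ¬ Hidden μ f k δ i S x

theorem measurableSet_hidden (f : Bdd ι X) (k : ℕ) (δ : ℝ) (i : ι) (S : Finset ι) :
    MeasurableSet {x | Hidden μ f k δ i S x} := by
  refine measurableSet_setOfPred.2 (Measurable.forall fun T => Measurable.imp measurable_const ?_)
  exact measurableSet_setOfPred.1 (measurableSet_lt (energy μ f k T (insert i T)).measurable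
    measurable_const)

theorem measurableSet_covered (f : Bdd ι X) (k : ℕ) (δ : ℝ) (S : Finset ι) :
    MeasurableSet {x | Covered μ f k δ S x} :=
  measurableSet_setOfPred.2 (Measurable.forall fun i => Measurable.imp measurable_const
    (measurableSet_setOfPred.1 (measurableSet_hidden f k δ i S)).not)

theorem dependsOn_hidden (f : Bdd ι X) (k : ℕ) (δ : ℝ) (i : ι) (S : Finset ι) :
    DependsOn (Hidden μ f k δ i S) (S : Set ι) := fun x y H => by
  refine propext (forall_congr' fun T => ?_)
  refine imp_congr_right fun hT => ?_
  rw [dependsOn_mono hT (dependsOn_energy f k T (insert i T)) H]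

theorem dependsOn_covered (f : Bdd ι X) (k : ℕ) (δ : ℝ) (S : Finset ι) :
    DependsOn (Covered μ f k δ S) (S : Set ι) := fun x y H => by
  refine propext (forall_congr' fun i => ?_)
  rw [dependsOn_hidden f k δ i S H]

/-- Deliberately crude: it trades the dependence on `R` for a sum over the subsets of `T`. -/
theorem condE_inter_le_sum {T R : Finset ι} {g : Bdd ι X} (hg : ∀ x, 0 ≤ g x) (x : ι → X) :
    condE μ (T ∩ R) g x ≤ ∑ U ∈ T.powerset, condE μ U g x :=
  Finset.single_le_sum (f := fun U => condE μ U g x) (fun _ _ => condE_nonneg hg x)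
    (Finset.mem_powerset.2 Finset.inter_subset_left)

variable (μ) in
/-- The component of `f` at `S ∋ i`, restricted to the event that `i` is hidden in `S`. -/
noncomputable def hiddenPart (f : Bdd ι X) (k : ℕ) (δ : ℝ) (i : ι) (S : Finset ι) : Bdd ι X :=
  if S ∈ lowSets ι k ∧ i ∈ S then
    comp μ S f * Bdd.ind _ (measurableSet_hidden (μ := μ) f k δ i S) else 0

theorem hiddenPart_eq_zero_of_card {f : Bdd ι X} {k : ℕ} {δ : ℝ} {i : ι} {S : Finset ι}
    (h : k < S.card) : hiddenPart μ f k δ i S = 0 := by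
  rw [hiddenPart, if_neg]
  exact fun h' => absurd (mem_lowSets.1 h'.1).2 (not_le.2 h)

theorem comp_mul_hiddenPart (f : Bdd ι X) (k : ℕ) (δ : ℝ) (i : ι) (S : Finset ι) :
    comp μ S f * hiddenPart μ f k δ i S = hiddenPart μ f k δ i S ^ 2 := by
  classical
  rw [hiddenPart]
  split_ifs
  · ext x
    simp only [Bdd.mul_apply, Bdd.pow_apply, Bdd.ind_apply]
    split_ifs <;> ring
  · simp

theorem hiddenPart_sq_le (f : Bdd ι X) (k : ℕ) (δ : ℝ) (i : ι) (S : Finset ι) (x : ι → X) :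
    (hiddenPart μ f k δ i S ^ 2 : Bdd ι X) x ≤ (comp μ S f ^ 2 : Bdd ι X) x := by
  classical
  rw [hiddenPart]
  split_ifs
  · simp only [Bdd.mul_apply, Bdd.pow_apply, Bdd.ind_apply]
    split_ifs
    · simp
    · simp [sq_nonneg]
  · simpa using sq_nonneg (comp μ S f x)

/-- Decide by the coordinates in `U`. If the energy above `insert i U` is below `δ`, it dominates
the sum, as the hidden part vanishes unless `i ∈ S`. Otherwise `U ⊆ T ⊆ S` exposes `i`, and every
hidden part in the sum vanishes on this event. -/
theorem sum_condE_hiddenPart_le {f : Bdd ι X} {k : ℕ} {δ : ℝ} (hδ : 0 < δ) (i : ι)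
    {T U : Finset ι} (hUT : U ⊆ T) (x : ι → X) :
    ∑ S with T ⊆ S, condE μ U (hiddenPart μ f k δ i S ^ 2) x ≤ δ := by
  by_cases h : energy μ f k U (insert i U) x < δ
  · refine le_trans ?_ h.le
    rw [energy, condE_sum_apply, Finset.sum_filter, Finset.sum_filter, lowSets, Finset.sum_filter]
    refine Finset.sum_le_sum fun S _ => ?_
    split_ifs with h1 h2 h3 h3
    · exact condE_mono (hiddenPart_sq_le f k δ i S) x
    · rw [hiddenPart, if_neg, zero_pow two_ne_zero, map_zero, Bdd.zero_apply]
      exact fun h' => h3 (Finset.insert_subset h'.2 (hUT.trans h1))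
    · rw [hiddenPart, if_neg, zero_pow two_ne_zero, map_zero, Bdd.zero_apply]
      exact fun h' => h2 (mem_lowSets.1 h'.1)
    · exact condE_nonneg (fun y => sq_nonneg _) x
    · exact le_rfl
    · exact le_rfl
  · refine le_trans (le_of_eq (Finset.sum_eq_zero fun S hS => ?_)) hδ.le
    have hTS : T ⊆ S := (Finset.mem_filter.1 hS).2
    have hm : MeasurableSet {y | energy μ f k U (insert i U) y < δ} :=
      measurableSet_lt (energy μ f k U (insert i U)).measurable measurable_const
    have hd : DependsOn (fun y => energy μ f k U (insert i U) y < δ) (U : Set ι) :=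
      fun y z H => by simp only [dependsOn_energy f k U (insert i U) H]
    have e : hiddenPart μ f k δ i S ^ 2
        = Bdd.ind (fun y => energy μ f k U (insert i U) y < δ) hm * hiddenPart μ f k δ i S ^ 2 := by
      ext y
      by_cases hy : energy μ f k U (insert i U) y < δ
      · rw [Bdd.mul_apply, Bdd.ind_of hm hy, one_mul]
      · rw [Bdd.mul_apply, Bdd.ind_of_not hm hy, zero_mul, hiddenPart]
        split_ifs
        · rw [Bdd.pow_apply, Bdd.mul_apply, Bdd.ind_of_not, mul_zero, zero_pow two_ne_zero]
          exact fun h' => hy (h' U (hUT.trans hTS))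
        · simp
    rw [e, condE_mul (dependsOn_ind hd), Bdd.mul_apply, Bdd.ind_of_not hm h, zero_mul]

theorem sum_powerset_two_pow_le {S : Finset ι} {k : ℕ} (hS : S.card ≤ k) :
    ∑ T ∈ S.powerset, (2 : ℝ) ^ T.card ≤ 4 ^ k := by
  calc ∑ T ∈ S.powerset, (2 : ℝ) ^ T.card ≤ ∑ T ∈ S.powerset, (2 : ℝ) ^ k :=
        Finset.sum_le_sum fun T hT => pow_le_pow_right₀ (by norm_num)
          ((Finset.card_le_card (Finset.mem_powerset.1 hT)).trans hS)
    _ = 2 ^ S.card * 2 ^ k := by simp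
    _ ≤ 2 ^ k * 2 ^ k := by gcongr; norm_num
    _ = 4 ^ k := by rw [← mul_pow]; norm_num

/-- The cut piece is no longer pure, and projecting it brings in conditioning on all `R ⊆ S`; given
`T` this becomes conditioning on `T ∩ R`. One factor `2 ^ k` is Cauchy–Schwarz, the other counts the
`R`. -/
theorem sum_condE_comp_hiddenPart_le (f : Bdd ι X) (k : ℕ) (δ : ℝ) (i : ι) (T : Finset ι)
    (x : ι → X) :
    ∑ S with T ⊆ S, condE μ T (comp μ S (hiddenPart μ f k δ i S) ^ 2) x
      ≤ 4 ^ k * ∑ U ∈ T.powerset, ∑ S with T ⊆ S,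
          condE μ U (hiddenPart μ f k δ i S ^ 2) x := by
  rw [Finset.sum_comm, Finset.mul_sum]
  refine Finset.sum_le_sum fun S _ => ?_
  have hnn : ∀ y, 0 ≤ (hiddenPart μ f k δ i S ^ 2 : Bdd ι X) y := fun y => sq_nonneg _
  have hs0 : 0 ≤ ∑ U ∈ T.powerset, condE μ U (hiddenPart μ f k δ i S ^ 2) x :=
    Finset.sum_nonneg fun U _ => condE_nonneg hnn x
  by_cases hS : k < S.card
  · rw [hiddenPart_eq_zero_of_card hS]; simp
  · have hS' := not_lt.1 hS
    calc condE μ T (comp μ S (hiddenPart μ f k δ i S) ^ 2) x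
        ≤ condE μ T ((2 : ℝ) ^ S.card •
            ∑ R ∈ S.powerset, condE μ R (hiddenPart μ f k δ i S ^ 2)) x := by
          refine condE_mono (fun y => ?_) x
          rw [Bdd.pow_apply, Bdd.smul_apply, Bdd.sum_apply]
          exact sq_comp_le S _ y
      _ = 2 ^ S.card * ∑ R ∈ S.powerset, condE μ (T ∩ R) (hiddenPart μ f k δ i S ^ 2) x := by
          rw [map_smul, Bdd.smul_apply, condE_sum_apply]
          simp only [condE_condE]
      _ ≤ 2 ^ S.card * ∑ R ∈ S.powerset, ∑ U ∈ T.powerset,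
            condE μ U (hiddenPart μ f k δ i S ^ 2) x := by
          gcongr with R _
          exact condE_inter_le_sum hnn x
      _ = 2 ^ S.card * 2 ^ S.card *
            ∑ U ∈ T.powerset, condE μ U (hiddenPart μ f k δ i S ^ 2) x := by
          simp [mul_assoc]
      _ ≤ 4 ^ k * ∑ U ∈ T.powerset, condE μ U (hiddenPart μ f k δ i S ^ 2) x := by
          refine mul_le_mul_of_nonneg_right ?_ hs0
          rw [← mul_pow]; norm_num
          exact pow_le_pow_right₀ (by norm_num) hS'

/-- In each squared second-moment sum one factor is bounded pointwise by means of `δ` and the other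
is integrated. The exponent 11 collects `16 ^ k` from the fourth moment, `(4 ^ k) ^ 2` from
projecting, `2 ^ k` for the subsets `U` of `T`, and `4 ^ k` from summing `2 ^ T.card` over `T ⊆ S`.
-/
theorem expect_pow_four_hiddenPart_le (f : Bdd ι X) (k : ℕ) {δ : ℝ} (hδ : 0 < δ) (i : ι) :
    expect μ ((∑ S, comp μ S (hiddenPart μ f k δ i S)) ^ 4)
      ≤ 2 ^ (11 * k) * δ * ∑ S, expect μ (hiddenPart μ f k δ i S ^ 2) := by
  set a : Finset ι → Bdd ι X := fun S => hiddenPart μ f k δ i S ^ 2 with ha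
  have hnn : ∀ S y, 0 ≤ a S y := fun S y => sq_nonneg _
  have ha0 : ∀ S, k < S.card → a S = 0 := fun S hS => by
    simp only [ha, hiddenPart_eq_zero_of_card hS, zero_pow two_ne_zero]
  have hE0 : ∀ S, 0 ≤ expect μ (a S) := fun S => expect_nonneg (hnn S)
  refine (expect_pow_four_le (fun S => isPure_comp S _) k fun S hS => ?_).trans ?_
  · rw [hiddenPart_eq_zero_of_card hS, map_zero]
  have key : ∀ T : Finset ι,
      expect μ ((∑ S with T ⊆ S, condE μ T (comp μ S (hiddenPart μ f k δ i S) ^ 2)) ^ 2)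
        ≤ 16 ^ k * 2 ^ k * δ * (2 ^ T.card * ∑ S with T ⊆ S, expect μ (a S)) := by
    intro T
    have hpt : ∀ x, ((∑ S with T ⊆ S,
        condE μ T (comp μ S (hiddenPart μ f k δ i S) ^ 2)) ^ 2 : Bdd ι X) x
        ≤ ((16 ^ k * 2 ^ k * δ) • ∑ U ∈ T.powerset, ∑ S with T ⊆ S, condE μ U (a S) : Bdd ι X) x := by
      intro x
      simp only [Bdd.pow_apply, Bdd.smul_apply, Bdd.sum_apply]
      set b := ∑ U ∈ T.powerset, ∑ S with T ⊆ S, condE μ U (a S) x with hb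
      have hb0 : 0 ≤ b := Finset.sum_nonneg fun U _ => Finset.sum_nonneg fun S _ =>
        condE_nonneg (hnn S) x
      have h1 := sum_condE_comp_hiddenPart_le (μ := μ) f k δ i T x
      have h0 : 0 ≤ ∑ S with T ⊆ S, condE μ T (comp μ S (hiddenPart μ f k δ i S) ^ 2) x :=
        Finset.sum_nonneg fun S _ => condE_nonneg (fun y => sq_nonneg _) x
      have hb1 : b * b ≤ 2 ^ k * δ * b := by
        by_cases hT : k < T.card
        · have : b = 0 := Finset.sum_eq_zero fun U _ => Finset.sum_eq_zero fun S hS => by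
            rw [ha0 S (hT.trans_le (Finset.card_le_card (Finset.mem_filter.1 hS).2)), map_zero,
              Bdd.zero_apply]
          rw [this]; simp
        · refine mul_le_mul_of_nonneg_right ?_ hb0
          calc b ≤ ∑ U ∈ T.powerset, δ := Finset.sum_le_sum fun U hU =>
                sum_condE_hiddenPart_le hδ i (Finset.mem_powerset.1 hU) x
            _ = 2 ^ T.card * δ := by simp
            _ ≤ 2 ^ k * δ := by
                gcongr
                · norm_num
                · exact not_lt.1 hT
      calc _ ≤ (4 ^ k * b) ^ 2 := pow_le_pow_left₀ h0 h1 2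
        _ = 16 ^ k * (b * b) := by
            rw [mul_pow, ← pow_mul, mul_comm k 2, pow_mul, sq b]; norm_num
        _ ≤ 16 ^ k * (2 ^ k * δ * b) := by gcongr
        _ = 16 ^ k * 2 ^ k * δ * b := by ring
    refine (expect_mono hpt).trans_eq ?_
    rw [map_smul, smul_eq_mul, map_sum]
    congr 1
    simp [map_sum, expect_condE]
  calc 16 ^ k * ∑ T, expect μ ((∑ S with T ⊆ S,
          condE μ T (comp μ S (hiddenPart μ f k δ i S) ^ 2)) ^ 2)
      ≤ 16 ^ k * ∑ T : Finset ι,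
          16 ^ k * 2 ^ k * δ * (2 ^ T.card * ∑ S with T ⊆ S, expect μ (a S)) := by
        gcongr with T _; exact key T
    _ = 16 ^ k * (16 ^ k * 2 ^ k * δ) * ∑ S, ∑ T ∈ S.powerset, 2 ^ T.card * expect μ (a S) := by
        have hsum : ∑ T : Finset ι, (2 ^ T.card * ∑ S with T ⊆ S, expect μ (a S))
            = ∑ S, ∑ T ∈ S.powerset, 2 ^ T.card * expect μ (a S) := by
          simp only [Finset.mul_sum]
          refine Finset.sum_comm' fun T S => ?_
          simp
        rw [← Finset.mul_sum, hsum, mul_assoc (16 ^ k : ℝ) _ (∑ S, _)]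
    _ ≤ 16 ^ k * (16 ^ k * 2 ^ k * δ) * ∑ S, 4 ^ k * expect μ (a S) := by
        gcongr with S _
        rw [← Finset.sum_mul]
        by_cases hS : k < S.card
        · rw [ha0 S hS]; simp
        · exact mul_le_mul_of_nonneg_right (sum_powerset_two_pow_le (not_lt.1 hS)) (hE0 S)
    _ = 2 ^ (11 * k) * δ * ∑ S, expect μ (a S) := by
        rw [← Finset.mul_sum, pow_mul]
        have : ((2 : ℝ) ^ 11) ^ k = 16 ^ k * 16 ^ k * 2 ^ k * 4 ^ k := by
          rw [← mul_pow, ← mul_pow, ← mul_pow]; norm_num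
        rw [this]; ring

/-- The hidden parts at `i` carry little energy compared with the influence of `i`. -/
theorem sum_expect_hiddenPart_le (f : Bdd ι X) (k : ℕ) {δ l : ℝ} (hδ : 0 < δ) (hl : 0 < l)
    (hδl : 2 * 2 ^ (11 * k) * δ ≤ l ^ 3) (i : ι)
    (hD : ∀ x, |(f - condE μ (Finset.univ.erase i) f : Bdd ι X) x| ≤ 1) :
    ∑ S, expect μ (hiddenPart μ f k δ i S ^ 2)
      ≤ 2 * l * expect μ (f - condE μ (Finset.univ.erase i) f).abs := by
  set E : Finset ι := Finset.univ.erase i with hE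
  set D : Bdd ι X := f - condE μ E f with hDdef
  set g : Bdd ι X := ∑ S, comp μ S (hiddenPart μ f k δ i S) with hg
  set a := ∑ S, expect μ (hiddenPart μ f k δ i S ^ 2) with ha
  have h4 : expect μ (g ^ 4) ≤ 2 ^ (11 * k) * δ * a := expect_pow_four_hiddenPart_le f k hδ i
  have ha0 : 0 ≤ a := Finset.sum_nonneg fun S _ => expect_nonneg fun x => sq_nonneg _
  -- Purity at `S ∋ i` discards the average over `i`, replaces `f` by its component at `S`, and then
  -- undoes the projection of the hidden part.
  have hDg : a = expect μ (D * g) := by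
    rw [hg, Finset.mul_sum, map_sum]
    refine Finset.sum_congr rfl fun S _ => ?_
    by_cases hS : i ∈ S
    · have hp := isPure_comp (μ := μ) S (hiddenPart μ f k δ i S)
      have h1 : expect μ (condE μ E f * comp μ S (hiddenPart μ f k δ i S)) = 0 := by
        rw [← expect_mul_condE (dependsOn_condE E f), hp.2 E fun h => by simpa [hE] using h hS,
          mul_zero, map_zero]
      rw [hDdef, sub_mul, map_sub, h1, sub_zero, mul_comm f, ← hp.expect_mul_comp f, mul_comm,
        (isPure_comp S f).expect_mul_comp, comp_mul_hiddenPart]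
    · rw [hiddenPart, if_neg fun h => hS h.2]; simp
  -- Where `|g| ≤ l` the first term suffices; elsewhere `|D| ≤ 1` and `|g| ≤ g⁴ / l³`.
  have hpt : ∀ x, (D * g : Bdd ι X) x ≤ (l • D.abs + (l⁻¹ ^ 3) • g ^ 4 : Bdd ι X) x := by
    intro x
    simp only [Bdd.mul_apply, Bdd.add_apply, Bdd.smul_apply, Bdd.pow_apply, Bdd.abs_apply]
    have hDx : |D x| ≤ 1 := hD x
    have h1 : D x * g x ≤ |D x| * |g x| := by rw [← abs_mul]; exact le_abs_self _
    have hg4 : g x ^ 4 = |g x| ^ 4 := by rw [← abs_pow]; exact (abs_of_nonneg (by positivity)).symm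
    rw [hg4]
    rcases le_or_gt |g x| l with h | h
    · have : 0 ≤ l⁻¹ ^ 3 * |g x| ^ 4 := by positivity
      nlinarith [mul_le_mul_of_nonneg_left h (abs_nonneg (D x))]
    · have h2 : |g x| ≤ l⁻¹ ^ 3 * |g x| ^ 4 := by
        have : 1 ≤ l⁻¹ ^ 3 * |g x| ^ 3 := by
          rw [← mul_pow]
          refine one_le_pow₀ ?_
          rw [inv_mul_eq_div, le_div_iff₀ hl]; linarith
        calc |g x| = 1 * |g x| := (one_mul _).symm
          _ ≤ l⁻¹ ^ 3 * |g x| ^ 3 * |g x| := by gcongr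
          _ = _ := by ring
      have h3 : |D x| * |g x| ≤ |g x| := mul_le_of_le_one_left (abs_nonneg _) hDx
      have h5 : 0 ≤ l * |D x| := by positivity
      linarith
  have hmain : a ≤ l * expect μ D.abs + l⁻¹ ^ 3 * (2 ^ (11 * k) * δ * a) := by
    calc a = expect μ (D * g) := hDg
      _ ≤ expect μ (l • D.abs + (l⁻¹ ^ 3) • g ^ 4) := expect_mono hpt
      _ = l * expect μ D.abs + l⁻¹ ^ 3 * expect μ (g ^ 4) := by
          rw [map_add, map_smul, map_smul]; rfl
      _ ≤ _ := by gcongr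
  -- The condition `hδl` serves to absorb the fourth-moment term into the left side.
  have hhalf : l⁻¹ ^ 3 * (2 ^ (11 * k) * δ * a) ≤ a / 2 := by
    have : l⁻¹ ^ 3 * (2 ^ (11 * k) * δ) ≤ 1 / 2 := by
      rw [inv_pow, inv_mul_le_iff₀ (by positivity)]; linarith
    nlinarith
  linarith

/-- The components of `f` on uncovered sets carry little energy. -/
theorem sum_expect_not_covered_le (f : Bdd ι X) (k : ℕ) {δ l : ℝ} (hδ : 0 < δ) (hl : 0 < l)
    (hδl : 2 * 2 ^ (11 * k) * δ ≤ l ^ 3)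
    (hD : ∀ i x, |(f - condE μ (Finset.univ.erase i) f : Bdd ι X) x| ≤ 1) :
    ∑ S ∈ lowSets ι k, expect μ (comp μ S f ^ 2 *
        (1 - Bdd.ind _ (measurableSet_covered (μ := μ) f k δ S)))
      ≤ 2 * l * ∑ i, expect μ (f - condE μ (Finset.univ.erase i) f).abs := by
  calc _ ≤ ∑ S ∈ lowSets ι k, ∑ i, expect μ (hiddenPart μ f k δ i S ^ 2) := by
        refine Finset.sum_le_sum fun S hS => ?_
        rw [← map_sum]
        refine expect_mono fun x => ?_
        rw [Bdd.sum_apply]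
        have hnn : ∀ i ∈ Finset.univ, 0 ≤ (hiddenPart μ f k δ i S ^ 2 : Bdd ι X) x :=
          fun i _ => sq_nonneg _
        by_cases hc : Covered μ f k δ S x
        · rw [Bdd.mul_apply, Bdd.sub_apply, Bdd.one_apply, Bdd.ind_of _ hc, sub_self, mul_zero]
          exact Finset.sum_nonneg hnn
        · have hc' := hc
          rw [Covered] at hc'
          push Not at hc'
          obtain ⟨i, hi, hh⟩ := hc'
          -- At a hidden coordinate `i` the whole component belongs to the hidden part.
          refine le_trans (le_of_eq ?_) (Finset.single_le_sum hnn (Finset.mem_univ i))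
          rw [hiddenPart, if_pos ⟨hS, hi⟩, Bdd.mul_apply, Bdd.sub_apply, Bdd.one_apply,
            Bdd.ind_of_not _ hc, Bdd.pow_apply, Bdd.pow_apply, Bdd.mul_apply, Bdd.ind_of _ hh]
          ring
    _ ≤ ∑ S, ∑ i, expect μ (hiddenPart μ f k δ i S ^ 2) :=
        Finset.sum_le_sum_of_subset_of_nonneg (Finset.subset_univ _) fun S _ _ =>
          Finset.sum_nonneg fun i _ => expect_nonneg fun x => sq_nonneg _
    _ ≤ _ := by
        rw [Finset.sum_comm, Finset.mul_sum]
        exact Finset.sum_le_sum fun i _ => sum_expect_hiddenPart_le f k hδ hl hδl i (hD i)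

end Coverage

/-! ### The expected number of covered sets. -/

section Counting

variable {ι X : Type*} [Fintype ι] [DecidableEq ι] [MeasurableSpace X]
variable {μ : Measure X} [IsProbabilityMeasure μ]

/-- Enlarging `R` by `j` applies the identity minus averaging over `j`; this keeps exactly the
components containing `j` and at most doubles the sup norm. -/
theorem abs_sum_comp_superset_le {f : Bdd ι X} (hf : ∀ x, |f x| ≤ 1) (R : Finset ι) :
    ∀ x, |(∑ S with R ⊆ S, comp μ S f : Bdd ι X) x| ≤ 2 ^ R.card := by
  induction R using Finset.induction_on with
  | empty => simpa [sum_comp_univ] using hf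
  | insert j R hj ih =>
    intro x
    set E : Finset ι := Finset.univ.erase j with hE
    set g : Bdd ι X := ∑ S with R ⊆ S, comp μ S f with hg
    have e : ∑ S with insert j R ⊆ S, comp μ S f = g - condE μ E g := by
      rw [hg, map_sum, ← Finset.sum_sub_distrib, Finset.sum_filter, Finset.sum_filter]
      refine Finset.sum_congr rfl fun S _ => ?_
      by_cases hRS : R ⊆ S
      · by_cases hjS : j ∈ S
        · rw [if_pos (Finset.insert_subset hjS hRS), if_pos hRS,
            (isPure_comp S f).2 E fun h => by simpa [hE] using h hjS, sub_zero]
        · rw [if_neg fun h => hjS (h (Finset.mem_insert_self _ _)), if_pos hRS,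
            (isPure_comp S f).condE_self, sub_self]
          intro i hi
          simp only [hE, Finset.mem_erase, Finset.mem_univ, and_true]
          exact fun e => hjS (e ▸ hi)
      · rw [if_neg fun h => hRS ((Finset.subset_insert _ _).trans h), if_neg hRS]
    have h2 : |condE μ E g x| ≤ 2 ^ R.card :=
      (abs_condE_le E g x).trans (condE_le_const (by simpa using ih) x)
    rw [e, Bdd.sub_apply, Finset.card_insert_of_notMem hj, pow_succ]
    calc |g x - condE μ E g x| ≤ |g x| + |condE μ E g x| := abs_sub _ _
      _ ≤ 2 ^ R.card + 2 ^ R.card := add_le_add (ih x) h2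
      _ = _ := by ring

/-- Bessel's inequality: the conditional energy above `R` is bounded. -/
theorem energy_self_le {f : Bdd ι X} (hf : ∀ x, |f x| ≤ 1) (k : ℕ) (R : Finset ι) (x : ι → X) :
    energy μ f k R R x ≤ 4 ^ R.card := by
  have h := condE_sq_sum (μ := μ) (𝒜 := Finset.univ.filter fun S => R ⊆ S) (R := R)
    (G := fun S => comp μ S f) (fun S _ => isPure_comp S f) fun S hS => (Finset.mem_filter.1 hS).2
  calc energy μ f k R R x
      ≤ ∑ S with R ⊆ S, condE μ R (comp μ S f ^ 2) x := by
        rw [energy, condE_sum_apply]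
        exact Finset.sum_le_sum_of_subset_of_nonneg
          (Finset.filter_subset_filter _ (Finset.subset_univ _))
          fun S _ _ => condE_nonneg (fun y => sq_nonneg _) x
    _ = condE μ R ((∑ S with R ⊆ S, comp μ S f) ^ 2) x := by rw [h, Bdd.sum_apply]
    _ ≤ 4 ^ R.card := by
        refine condE_le_const (fun y => ?_) x
        rw [Bdd.pow_apply, ← sq_abs]
        refine (pow_le_pow_left₀ (abs_nonneg _) (abs_sum_comp_superset_le hf R y) 2).trans_eq ?_
        rw [← pow_mul, mul_comm, pow_mul]; norm_num

theorem energy_le {f : Bdd ι X} (hf : ∀ x, |f x| ≤ 1) (k : ℕ) {U R : Finset ι} (hU : U ⊆ R)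
    (x : ι → X) : energy μ f k U R x ≤ 4 ^ R.card := by
  have : energy μ f k U R = condE μ U (energy μ f k R R) := by
    rw [energy, energy, condE_condE, Finset.inter_eq_left.2 hU]
  rw [this]
  exact condE_le_const (energy_self_le hf k R) x

variable (μ) in
/-- `T` carries large energy, given some of its coordinates. -/
def Heavy (f : Bdd ι X) (k : ℕ) (δ : ℝ) (T : Finset ι) (x : ι → X) : Prop :=
  ∃ U, U ⊆ T ∧ δ ≤ energy μ f k U T x

theorem measurableSet_heavy (f : Bdd ι X) (k : ℕ) (δ : ℝ) (T : Finset ι) :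
    MeasurableSet {x | Heavy μ f k δ T x} := by
  refine measurableSet_setOfPred.2 (Measurable.exists fun U => Measurable.and measurable_const ?_)
  exact measurableSet_setOfPred.1 (measurableSet_le measurable_const
    (energy μ f k U T).measurable)

theorem dependsOn_heavy (f : Bdd ι X) (k : ℕ) (δ : ℝ) (T : Finset ι) :
    DependsOn (Heavy μ f k δ T) (T : Set ι) := fun x y H => by
  refine propext (exists_congr fun U => ?_)
  refine and_congr_right fun hU => ?_
  rw [dependsOn_mono hU (dependsOn_energy f k U T) H]

variable (μ) in
/-- The indicator function of heaviness. -/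
noncomputable def heavyInd (f : Bdd ι X) (k : ℕ) (δ : ℝ) (T : Finset ι) : Bdd ι X :=
  Bdd.ind _ (measurableSet_heavy (μ := μ) f k δ T)

theorem heavyInd_nonneg (f : Bdd ι X) (k : ℕ) (δ : ℝ) (T : Finset ι) (x : ι → X) :
    0 ≤ heavyInd μ f k δ T x := Bdd.ind_nonneg _ _ _

theorem dependsOn_heavyInd (f : Bdd ι X) (k : ℕ) (δ : ℝ) (T : Finset ι) :
    DependsOn (heavyInd μ f k δ T : (ι → X) → ℝ) (T : Set ι) :=
  dependsOn_ind (dependsOn_heavy f k δ T)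

/-- A Markov bound, summed over all possible witnesses `U`. -/
theorem heavyInd_le (f : Bdd ι X) (k : ℕ) {δ : ℝ} (hδ : 0 < δ) (T : Finset ι) (x : ι → X) :
    heavyInd μ f k δ T x ≤ δ⁻¹ * ∑ U ∈ T.powerset, energy μ f k U T x := by
  by_cases h : Heavy μ f k δ T x
  · rw [heavyInd, Bdd.ind_of _ h, inv_mul_eq_div, le_div_iff₀ hδ, one_mul]
    obtain ⟨U, hU, h⟩ := h
    exact h.trans (Finset.single_le_sum (f := fun U => energy μ f k U T x)
      (fun U _ => energy_nonneg f k U T x) (Finset.mem_powerset.2 hU))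
  · rw [heavyInd, Bdd.ind_of_not _ h]
    exact mul_nonneg (inv_nonneg.2 hδ.le) (Finset.sum_nonneg fun U _ => energy_nonneg f k U T x)

/-- Given the coordinates in `R`, few supersets of `R` are heavy on average. -/
theorem sum_condE_heavyInd_le {f : Bdd ι X} (hf : ∀ x, |f x| ≤ 1) {k : ℕ} {δ : ℝ} (hδ : 0 < δ)
    {R : Finset ι} (hR : R.card ≤ k) (x : ι → X) :
    ∑ T with R ⊆ T, condE μ R (heavyInd μ f k δ T) x ≤ 32 ^ k / δ := by
  have hsq : ∀ S y, 0 ≤ (comp μ S f ^ 2 : Bdd ι X) y := fun S y => sq_nonneg _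
  have hc0 : ∀ U S, 0 ≤ condE μ U (comp μ S f ^ 2) x := fun U S => condE_nonneg (hsq S) x
  have h1 : ∀ T, condE μ R (heavyInd μ f k δ T) x
      ≤ δ⁻¹ * (2 ^ T.card * ∑ U ∈ R.powerset, energy μ f k U T x) := by
    intro T
    have hnn : ∀ y, 0 ≤ (∑ S ∈ lowSets ι k with T ⊆ S, comp μ S f ^ 2 : Bdd ι X) y := fun y => by
      rw [Bdd.sum_apply]; exact Finset.sum_nonneg fun S _ => hsq S y
    calc condE μ R (heavyInd μ f k δ T) x
        ≤ condE μ R (δ⁻¹ • ∑ U ∈ T.powerset, energy μ f k U T) x := by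
          refine condE_mono (fun y => ?_) x
          rw [Bdd.smul_apply, Bdd.sum_apply]
          exact heavyInd_le f k hδ T y
      _ = δ⁻¹ * ∑ U ∈ T.powerset, condE μ (R ∩ U)
            (∑ S ∈ lowSets ι k with T ⊆ S, comp μ S f ^ 2) x := by
          rw [map_smul, Bdd.smul_apply, condE_sum_apply]
          simp only [energy, condE_condE]
      _ ≤ δ⁻¹ * ∑ U ∈ T.powerset, ∑ W ∈ R.powerset, energy μ f k W T x := by
          gcongr with U _
          exact condE_inter_le_sum hnn x
      _ = _ := by simp
  -- Exchanging sums, a low set `S` is counted with weight at most `∑ T ⊆ S, 2 ^ T.card ≤ 4 ^ k`;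
  -- the other `4 ^ k` is Bessel's inequality. With `2 ^ k` for the choice of `U` this gives the
  -- base 32.
  have h2 : ∀ U ∈ R.powerset, ∑ T with R ⊆ T, 2 ^ T.card * energy μ f k U T x
      ≤ 4 ^ k * 4 ^ k := by
    intro U hU
    calc ∑ T with R ⊆ T, 2 ^ T.card * energy μ f k U T x
        = ∑ T with R ⊆ T, ∑ S ∈ lowSets ι k with T ⊆ S,
            2 ^ T.card * condE μ U (comp μ S f ^ 2) x := by
          refine Finset.sum_congr rfl fun T _ => ?_
          rw [energy, condE_sum_apply, Finset.mul_sum]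
      _ = ∑ S ∈ lowSets ι k with R ⊆ S, ∑ T ∈ S.powerset with R ⊆ T,
            2 ^ T.card * condE μ U (comp μ S f ^ 2) x := by
          refine Finset.sum_comm' fun T S => ?_
          simp only [Finset.mem_filter, Finset.mem_univ, true_and, Finset.mem_powerset]
          exact ⟨fun ⟨a, b, c⟩ => ⟨⟨c, a⟩, b, a.trans c⟩, fun ⟨⟨a, b⟩, c, _⟩ => ⟨b, c, a⟩⟩
      _ ≤ ∑ S ∈ lowSets ι k with R ⊆ S, 4 ^ k * condE μ U (comp μ S f ^ 2) x := by
          refine Finset.sum_le_sum fun S hS => ?_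
          rw [← Finset.sum_mul]
          refine mul_le_mul_of_nonneg_right (le_trans ?_ (sum_powerset_two_pow_le
            (mem_lowSets.1 (Finset.mem_filter.1 hS).1).2)) (hc0 U S)
          exact Finset.sum_le_sum_of_subset_of_nonneg (Finset.filter_subset _ _)
            fun _ _ _ => by positivity
      _ = 4 ^ k * energy μ f k U R x := by
          rw [← Finset.mul_sum, energy, condE_sum_apply]
      _ ≤ 4 ^ k * 4 ^ k := by
          gcongr
          exact (energy_le hf k (Finset.mem_powerset.1 hU) x).trans
            (pow_le_pow_right₀ (by norm_num) hR)
  calc ∑ T with R ⊆ T, condE μ R (heavyInd μ f k δ T) x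
      ≤ ∑ T with R ⊆ T, δ⁻¹ * (2 ^ T.card * ∑ U ∈ R.powerset, energy μ f k U T x) :=
        Finset.sum_le_sum fun T _ => h1 T
    _ = δ⁻¹ * ∑ U ∈ R.powerset, ∑ T with R ⊆ T, 2 ^ T.card * energy μ f k U T x := by
        rw [← Finset.mul_sum, Finset.sum_comm]
        simp only [Finset.mul_sum]
    _ ≤ δ⁻¹ * ∑ U ∈ R.powerset, 4 ^ k * 4 ^ k := by
        gcongr with U hU; exact h2 U hU
    _ = δ⁻¹ * (2 ^ R.card * (4 ^ k * 4 ^ k)) := by simp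
    _ ≤ δ⁻¹ * (2 ^ k * (4 ^ k * 4 ^ k)) := by gcongr; norm_num
    _ = 32 ^ k / δ := by
        rw [← mul_pow, ← mul_pow, inv_mul_eq_div]; norm_num

variable (μ) in
/-- The number of ways to write `S` as a union of `j` heavy sets in order. -/
noncomputable def unionCount (f : Bdd ι X) (k : ℕ) (δ : ℝ) : ℕ → Finset ι → Bdd ι X
  | 0, S => if S = ∅ then 1 else 0
  | j + 1, S => ∑ V, ∑ T, if V ∪ T = S then unionCount f k δ j V * heavyInd μ f k δ T else 0

theorem unionCount_nonneg (f : Bdd ι X) (k : ℕ) (δ : ℝ) (j : ℕ) (S : Finset ι) (x : ι → X) :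
    0 ≤ unionCount μ f k δ j S x := by
  induction j generalizing S with
  | zero => rw [unionCount]; split_ifs <;> simp
  | succ j ih =>
    rw [unionCount, Bdd.sum_apply]
    refine Finset.sum_nonneg fun V _ => ?_
    rw [Bdd.sum_apply]
    refine Finset.sum_nonneg fun T _ => ?_
    split_ifs
    · exact mul_nonneg (ih V) (heavyInd_nonneg f k δ T x)
    · exact le_rfl

theorem dependsOn_unionCount (f : Bdd ι X) (k : ℕ) (δ : ℝ) (j : ℕ) (S : Finset ι) :
    DependsOn (unionCount μ f k δ j S : (ι → X) → ℝ) (S : Set ι) := by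
  induction j generalizing S with
  | zero => rw [unionCount]; split_ifs <;> exact fun _ _ _ => rfl
  | succ j ih =>
    rw [unionCount]
    refine dependsOn_sum fun V _ => dependsOn_sum fun T _ => ?_
    split_ifs with h
    · subst h
      exact dependsOn_mul (dependsOn_mono Finset.subset_union_left (ih V))
        (dependsOn_mono Finset.subset_union_right (dependsOn_heavyInd f k δ T))
    · exact fun _ _ _ => rfl

/-- Adjoin heavy sets one at a time. Given the coordinates in the current union `V`, heaviness of
`T` only feels those in `R = V ∩ T`; there are at most `2 ^ k` such `R`, each contributing at most
`32 ^ k / δ`. -/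
theorem sum_expect_unionCount_le {f : Bdd ι X} (hf : ∀ x, |f x| ≤ 1) {k : ℕ} {δ : ℝ}
    (hδ : 0 < δ) (j : ℕ) :
    ∑ S : Finset ι with S.card ≤ k, expect μ (unionCount μ f k δ j S) ≤ (64 ^ k / δ) ^ j := by
  induction j with
  | zero =>
    simp only [unionCount, pow_zero]
    rw [Finset.sum_eq_single ∅]
    · simp [expect_one]
    · intro S _ h; simp [h]
    · simp
  | succ j ih =>
    have hnn : ∀ V T, 0 ≤ expect μ (unionCount μ f k δ j V * heavyInd μ f k δ T) := fun V T =>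
      expect_nonneg fun x => mul_nonneg (unionCount_nonneg f k δ j V x) (heavyInd_nonneg f k δ T x)
    calc ∑ S : Finset ι with S.card ≤ k, expect μ (unionCount μ f k δ (j + 1) S)
        = ∑ S : Finset ι with S.card ≤ k, ∑ V, ∑ T, if V ∪ T = S then
            expect μ (unionCount μ f k δ j V * heavyInd μ f k δ T) else 0 := by
          refine Finset.sum_congr rfl fun S _ => ?_
          rw [unionCount]
          simp only [map_sum, apply_ite (expect μ), map_zero]
      _ = ∑ V, ∑ T, ∑ S : Finset ι with S.card ≤ k, if V ∪ T = S then
            expect μ (unionCount μ f k δ j V * heavyInd μ f k δ T) else 0 := by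
          rw [Finset.sum_comm]
          refine Finset.sum_congr rfl fun V _ => ?_
          rw [Finset.sum_comm]
      _ ≤ ∑ V, ∑ T, if V.card ≤ k then
            expect μ (unionCount μ f k δ j V * heavyInd μ f k δ T) else 0 := by
          refine Finset.sum_le_sum fun V _ => Finset.sum_le_sum fun T _ => ?_
          rw [Finset.sum_ite_eq]
          split_ifs with h1 h2 h2
          · exact le_rfl
          · exact absurd ((Finset.card_le_card Finset.subset_union_left).trans
              (Finset.mem_filter.1 h1).2) h2
          · exact hnn V T
          · exact le_rfl
      _ = ∑ V : Finset ι with V.card ≤ k, expect μ (unionCount μ f k δ j V *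
            ∑ T, condE μ V (heavyInd μ f k δ T)) := by
          rw [Finset.sum_filter]
          refine Finset.sum_congr rfl fun V _ => ?_
          split_ifs
          · rw [Finset.mul_sum, map_sum]
            refine Finset.sum_congr rfl fun T _ => ?_
            rw [expect_mul_condE (dependsOn_unionCount f k δ j V)]
          · simp
      _ ≤ ∑ V : Finset ι with V.card ≤ k, expect μ ((64 ^ k / δ) • unionCount μ f k δ j V) := by
          refine Finset.sum_le_sum fun V hV => expect_mono fun x => ?_
          have hVk : V.card ≤ k := (Finset.mem_filter.1 hV).2
          rw [Bdd.mul_apply, Bdd.smul_apply, mul_comm]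
          refine mul_le_mul_of_nonneg_right ?_ (unionCount_nonneg f k δ j V x)
          rw [Bdd.sum_apply]
          calc ∑ T, condE μ V (heavyInd μ f k δ T) x
              ≤ ∑ T, ∑ R ∈ V.powerset with R ⊆ T, condE μ R (heavyInd μ f k δ T) x := by
                refine Finset.sum_le_sum fun T _ => ?_
                rw [← condE_inter_of_dependsOn (dependsOn_heavyInd f k δ T)]
                exact Finset.single_le_sum
                  (f := fun R => condE μ R (heavyInd μ f k δ T) x)
                  (fun R _ => condE_nonneg (heavyInd_nonneg f k δ T) x)
                  (Finset.mem_filter.2 ⟨Finset.mem_powerset.2 Finset.inter_subset_left,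
                    Finset.inter_subset_right⟩)
            _ = ∑ R ∈ V.powerset, ∑ T with R ⊆ T, condE μ R (heavyInd μ f k δ T) x := by
                refine Finset.sum_comm' fun T R => ?_
                simp [and_comm]
            _ ≤ ∑ R ∈ V.powerset, 32 ^ k / δ := Finset.sum_le_sum fun R hR =>
                sum_condE_heavyInd_le hf hδ
                  ((Finset.card_le_card (Finset.mem_powerset.1 hR)).trans hVk) x
            _ = 2 ^ V.card * (32 ^ k / δ) := by simp
            _ ≤ 2 ^ k * (32 ^ k / δ) := by gcongr; norm_num
            _ = 64 ^ k / δ := by rw [← mul_div_assoc, ← mul_pow]; norm_num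
      _ = (64 ^ k / δ) * ∑ V : Finset ι with V.card ≤ k, expect μ (unionCount μ f k δ j V) := by
          rw [Finset.mul_sum]; simp only [map_smul, smul_eq_mul]
      _ ≤ (64 ^ k / δ) * (64 ^ k / δ) ^ j := by gcongr
      _ = _ := (pow_succ' _ _).symm

theorem one_le_unionCount {f : Bdd ι X} {k : ℕ} {δ : ℝ} {x : ι → X} {t : ι → Finset ι}
    (A : Finset ι) (h : ∀ i ∈ A, Heavy μ f k δ (t i) x) :
    1 ≤ unionCount μ f k δ A.card (A.biUnion t) x := by
  induction A using Finset.induction_on with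
  | empty => simp [unionCount]
  | insert a A ha ih =>
    have ih' := ih fun i hi => h i (Finset.mem_insert_of_mem hi)
    rw [Finset.card_insert_of_notMem ha, unionCount, Bdd.sum_apply]
    have hnn : ∀ V T, 0 ≤ (if V ∪ T = (insert a A).biUnion t then
        unionCount μ f k δ A.card V * heavyInd μ f k δ T else 0 : Bdd ι X) x := by
      intro V T
      split_ifs
      · exact mul_nonneg (unionCount_nonneg f k δ _ V x) (heavyInd_nonneg f k δ T x)
      · exact le_rfl
    have h1 : 1 ≤ (if A.biUnion t ∪ t a = (insert a A).biUnion t then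
        unionCount μ f k δ A.card (A.biUnion t) * heavyInd μ f k δ (t a) else 0 : Bdd ι X) x := by
      rw [if_pos (by rw [Finset.biUnion_insert, Finset.union_comm]), Bdd.mul_apply, heavyInd,
        Bdd.ind_of _ (h a (Finset.mem_insert_self _ _)), mul_one]
      exact ih'
    refine h1.trans ((Finset.single_le_sum (f := fun T => (if A.biUnion t ∪ T = (insert a A).biUnion t
      then unionCount μ f k δ A.card (A.biUnion t) * heavyInd μ f k δ T else 0 : Bdd ι X) x)
      (fun T _ => hnn _ T) (Finset.mem_univ (t a))).trans ?_)
    rw [← Bdd.sum_apply]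
    refine Finset.single_le_sum (f := fun V => (∑ T, if V ∪ T = (insert a A).biUnion t
      then unionCount μ f k δ A.card V * heavyInd μ f k δ T else 0 : Bdd ι X) x)
      (fun V _ => ?_) (Finset.mem_univ (A.biUnion t))
    rw [Bdd.sum_apply]
    exact Finset.sum_nonneg fun T _ => hnn V T

/-- If `T i ⊆ S` exposes `i`, then `insert i (T i)` is heavy, contains `i` and stays inside `S`; the
union of these sets over `i ∈ S` is exactly `S`. -/
theorem one_le_unionCount_of_covered {f : Bdd ι X} {k : ℕ} {δ : ℝ} {x : ι → X} {S : Finset ι}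
    (h : Covered μ f k δ S x) : 1 ≤ unionCount μ f k δ S.card S x := by
  have h' : ∀ i, ∃ T, i ∈ S → T ⊆ S ∧ δ ≤ energy μ f k T (insert i T) x := by
    intro i
    by_cases hi : i ∈ S
    · have := h i hi
      rw [Hidden] at this
      push Not at this
      obtain ⟨T, hT, hT'⟩ := this
      exact ⟨T, fun _ => ⟨hT, hT'⟩⟩
    · exact ⟨∅, fun h => absurd h hi⟩
  choose T hT using h'
  have hS : S.biUnion (fun i => insert i (T i)) = S := by
    ext j
    simp only [Finset.mem_biUnion]
    constructor
    · rintro ⟨i, hi, hj⟩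
      exact Finset.insert_subset hi (hT i hi).1 hj
    · exact fun hj => ⟨j, hj, Finset.mem_insert_self _ _⟩
  have := one_le_unionCount (μ := μ) (f := f) (k := k) (δ := δ) (x := x)
    (t := fun i => insert i (T i)) S fun i hi => ⟨T i, Finset.subset_insert _ _, (hT i hi).2⟩
  rwa [hS] at this

/-- The expected number of covered sets is bounded. -/
theorem sum_expect_covered_le {f : Bdd ι X} (hf : ∀ x, |f x| ≤ 1) {k : ℕ} {δ : ℝ} (hδ : 0 < δ) :
    ∑ S ∈ lowSets ι k, expect μ (Bdd.ind _ (measurableSet_covered (μ := μ) f k δ S))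
      ≤ ∑ j ∈ Finset.range (k + 1), (64 ^ k / δ) ^ j := by
  calc _ ≤ ∑ S ∈ lowSets ι k, ∑ j ∈ Finset.range (k + 1), expect μ (unionCount μ f k δ j S) := by
        refine Finset.sum_le_sum fun S hS => ?_
        rw [← map_sum]
        refine expect_mono fun x => ?_
        rw [Bdd.sum_apply]
        have hnn : ∀ j ∈ Finset.range (k + 1), 0 ≤ unionCount μ f k δ j S x :=
          fun j _ => unionCount_nonneg f k δ j S x
        by_cases h : Covered μ f k δ S x
        · rw [Bdd.ind_of _ h]
          exact (one_le_unionCount_of_covered h).trans (Finset.single_le_sum hnn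
            (Finset.mem_range.2 (Nat.lt_succ_of_le (mem_lowSets.1 hS).2)))
        · rw [Bdd.ind_of_not _ h]
          exact Finset.sum_nonneg hnn
    _ = ∑ j ∈ Finset.range (k + 1), ∑ S ∈ lowSets ι k, expect μ (unionCount μ f k δ j S) :=
        Finset.sum_comm
    _ ≤ _ := by
        refine Finset.sum_le_sum fun j _ => le_trans ?_ (sum_expect_unionCount_le (μ := μ) hf hδ j)
        refine Finset.sum_le_sum_of_subset_of_nonneg ?_ fun S _ _ =>
          expect_nonneg (unionCount_nonneg f k δ j S)
        intro S hS
        simpa using (mem_lowSets.1 hS).2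

end Counting

/-! ### Cutting to revealed sets, with corrections from larger to smaller sets. -/

section Truncation

variable {ι X : Type*} [Fintype ι] [DecidableEq ι] [MeasurableSpace X]
variable {μ : Measure X} [IsProbabilityMeasure μ]

variable (μ) in
/-- `S` is covered, or the correction `Γ` at `S` is large, both absolutely and compared with the
component of `f` at `S`. -/
def RevealedBy (f : Bdd ι X) (k : ℕ) (δ θ η : ℝ) (S : Finset ι) (Γ : Bdd ι X) (x : ι → X) :
    Prop :=
  Covered μ f k δ S x ∨ (θ * |comp μ S f x| ≤ |Γ x| ∧ η ≤ |Γ x|)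

theorem measurableSet_revealedBy (f : Bdd ι X) (k : ℕ) (δ θ η : ℝ) (S : Finset ι) (Γ : Bdd ι X) :
    MeasurableSet {x | RevealedBy μ f k δ θ η S Γ x} :=
  (measurableSet_covered f k δ S).union
    ((measurableSet_le ((comp μ S f).abs.measurable.const_mul θ) Γ.abs.measurable).inter
      (measurableSet_le measurable_const Γ.abs.measurable))

variable (μ) in
/-- The part of `F_S + Γ` on the event that `S` is revealed. -/
noncomputable def revealedPart (f : Bdd ι X) (k : ℕ) (δ θ η : ℝ) (S : Finset ι) (Γ : Bdd ι X) :
    Bdd ι X :=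
  if S ∈ lowSets ι k then
    (comp μ S f + Γ) * Bdd.ind _ (measurableSet_revealedBy (μ := μ) f k δ θ η S Γ)
  else 0

variable (μ) in
/-- The revealed parts, where the correction at `S` compensates the lower components of the
revealed parts at the proper supersets of `S`. -/
noncomputable def kept (f : Bdd ι X) (k : ℕ) (δ θ η : ℝ) : Finset ι → Bdd ι X :=
  (wellFounded_gt (α := Finset ι)).fix fun S K =>
    revealedPart μ f k δ θ η S
      (-∑ T ∈ (Finset.univ.filter fun T : Finset ι => S ⊂ T).attach,
        comp μ S (K T.1 (Finset.mem_filter.1 T.2).2))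

variable (μ) in
/-- The correction at `S`. -/
noncomputable def corr (f : Bdd ι X) (k : ℕ) (δ θ η : ℝ) (S : Finset ι) : Bdd ι X :=
  -∑ T with S ⊂ T, comp μ S (kept μ f k δ θ η T)

theorem kept_eq (f : Bdd ι X) (k : ℕ) (δ θ η : ℝ) (S : Finset ι) :
    kept μ f k δ θ η S = revealedPart μ f k δ θ η S (corr μ f k δ θ η S) := by
  rw [kept, WellFounded.fix_eq, ← kept, corr,
    ← Finset.sum_attach (Finset.univ.filter fun T : Finset ι => S ⊂ T)]

theorem kept_eq_zero {f : Bdd ι X} {k : ℕ} {δ θ η : ℝ} {S : Finset ι} (h : S ∉ lowSets ι k) :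
    kept μ f k δ θ η S = 0 := by
  rw [kept_eq, revealedPart, if_neg h]

variable (μ) in
/-- `S` is revealed. -/
def Revealed (f : Bdd ι X) (k : ℕ) (δ θ η : ℝ) (S : Finset ι) (x : ι → X) : Prop :=
  RevealedBy μ f k δ θ η S (corr μ f k δ θ η S) x

theorem measurableSet_revealed (f : Bdd ι X) (k : ℕ) (δ θ η : ℝ) (S : Finset ι) :
    MeasurableSet {x | Revealed μ f k δ θ η S x} :=
  measurableSet_revealedBy f k δ θ η S _

theorem kept_apply_of_revealed {f : Bdd ι X} {k : ℕ} {δ θ η : ℝ} {S : Finset ι} {x : ι → X}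
    (hS : S ∈ lowSets ι k) (h : Revealed μ f k δ θ η S x) :
    kept μ f k δ θ η S x = comp μ S f x + corr μ f k δ θ η S x := by
  rw [kept_eq, revealedPart, if_pos hS, Bdd.mul_apply,
    Bdd.ind_of (measurableSet_revealedBy f k δ θ η S _) h, mul_one, Bdd.add_apply]

theorem kept_apply_of_not_revealed {f : Bdd ι X} {k : ℕ} {δ θ η : ℝ} {S : Finset ι} {x : ι → X}
    (h : ¬ Revealed μ f k δ θ η S x) : kept μ f k δ θ η S x = 0 := by
  rw [kept_eq, revealedPart]
  split_ifs
  · rw [Bdd.mul_apply, Bdd.ind_of_not (measurableSet_revealedBy f k δ θ η S _) h, mul_zero]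
  · rfl

theorem isPure_corr (f : Bdd ι X) (k : ℕ) (δ θ η : ℝ) (S : Finset ι) :
    IsPure μ S (corr μ f k δ θ η S) := by
  have := (IsPure.sum (μ := μ) (s := Finset.univ.filter fun T : Finset ι => S ⊂ T)
    (G := fun T => comp μ S (kept μ f k δ θ η T)) fun T _ => isPure_comp S _).smul (-1)
  rwa [neg_one_smul] at this

theorem dependsOn_revealed (f : Bdd ι X) (k : ℕ) (δ θ η : ℝ) (S : Finset ι) :
    DependsOn (Revealed μ f k δ θ η S) (S : Set ι) := fun x y H => by
  simp only [Revealed, RevealedBy, dependsOn_covered f k δ S H, (isPure_comp S f).1 H,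
    (isPure_corr f k δ θ η S).1 H]

theorem dependsOn_kept (f : Bdd ι X) (k : ℕ) (δ θ η : ℝ) (S : Finset ι) :
    DependsOn (kept μ f k δ θ η S : (ι → X) → ℝ) (S : Set ι) := by
  rw [kept_eq, revealedPart]
  split_ifs
  · exact dependsOn_mul (dependsOn_add (isPure_comp S f).1 (isPure_corr f k δ θ η S).1)
      (dependsOn_ind (dependsOn_revealed f k δ θ η S))
  · exact fun _ _ _ => rfl

variable (μ) in
/-- The part of the corrected component at `S` that is not revealed. -/
noncomputable def lost (f : Bdd ι X) (k : ℕ) (δ θ η : ℝ) (S : Finset ι) : Bdd ι X :=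
  comp μ S f + corr μ f k δ θ η S - kept μ f k δ θ η S

/-- The low-degree part of `f` is, up to a constant, the sum of the kept parts and of the top
components of the lost parts. -/
theorem sum_comp_eq_kept_add_lost (f : Bdd ι X) (k : ℕ) (δ θ η : ℝ) :
    ∑ S ∈ lowSets ι k, comp μ S f
      = ∑ S ∈ lowSets ι k, comp μ S (lost μ f k δ θ η S)
        + ∑ S ∈ lowSets ι k, (kept μ f k δ θ η S - expect μ (kept μ f k δ θ η S) • 1) := by
  set K := kept μ f k δ θ η with hK
  have h1 : ∀ S ∈ lowSets ι k, comp μ S (lost μ f k δ θ η S)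
      = comp μ S f - ∑ T ∈ lowSets ι k with S ⊆ T, comp μ S (K T) := by
    intro S hS
    rw [lost, map_sub, map_add, (isPure_comp S f).comp_self, (isPure_corr f k δ θ η S).comp_self,
      corr]
    have : ∑ T ∈ lowSets ι k with S ⊆ T, comp μ S (K T)
        = comp μ S (K S) + ∑ T with S ⊂ T, comp μ S (K T) := by
      have e1 : ∑ T ∈ lowSets ι k with S ⊆ T, comp μ S (K T) = ∑ T with S ⊆ T, comp μ S (K T) := by
        refine Finset.sum_subset (Finset.filter_subset_filter _ (Finset.subset_univ _)) ?_
        intro T hT hT'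
        have : T ∉ lowSets ι k := fun h =>
          hT' (Finset.mem_filter.2 ⟨h, (Finset.mem_filter.1 hT).2⟩)
        rw [hK, kept_eq_zero this, map_zero]
      have e2 : (Finset.univ.filter fun T => S ⊆ T)
          = insert S (Finset.univ.filter fun T => S ⊂ T) := by
        ext T
        simp only [Finset.mem_filter, Finset.mem_univ, true_and, Finset.mem_insert]
        rw [subset_iff_ssubset_or_eq, or_comm, eq_comm]
      rw [e1, e2, Finset.sum_insert (by simp)]
    rw [this]
    abel
  -- After exchanging the sums, the components of `K T` below `T` add up to `K T`. Only the one at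
  -- `∅` is missing from `lowSets`, hence the subtracted mean.
  have h2 : ∑ S ∈ lowSets ι k, ∑ T ∈ lowSets ι k with S ⊆ T, comp μ S (K T)
      = ∑ T ∈ lowSets ι k, (K T - expect μ (K T) • 1) := by
    calc _ = ∑ T ∈ lowSets ι k, ∑ S ∈ T.powerset.erase ∅, comp μ S (K T) := by
          refine Finset.sum_comm' fun S T => ?_
          simp only [Finset.mem_filter, mem_lowSets, Finset.mem_erase, Finset.mem_powerset, ne_eq,
            ← Finset.nonempty_iff_ne_empty]
          exact ⟨fun ⟨a, b, c⟩ => ⟨⟨a.1, c⟩, b⟩,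
            fun ⟨⟨a, b⟩, c⟩ => ⟨⟨a, (Finset.card_le_card b).trans c.2⟩, c, b⟩⟩
      _ = _ := by
          refine Finset.sum_congr rfl fun T _ => ?_
          rw [← comp_empty, eq_sub_iff_add_eq, Finset.sum_erase_add _ _ (by simp),
            sum_comp_of_dependsOn (dependsOn_kept f k δ θ η T)]
  rw [Finset.sum_congr rfl h1, Finset.sum_sub_distrib, h2]
  abel

/-- If `S` is covered, use `|F| ≤ (F² + 1)/2`, where the indicator pays for the 1; if it is revealed
by its correction `Γ`, use `|F| ≤ |Γ|/θ`. -/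
theorem abs_kept_le (f : Bdd ι X) (k : ℕ) {δ θ η : ℝ} (hθ : 0 < θ) (S : Finset ι) (x : ι → X) :
    |kept μ f k δ θ η S x| ≤ (1 / 2) * (comp μ S f x ^ 2 +
        Bdd.ind _ (measurableSet_covered (μ := μ) f k δ S) x)
      + (1 + 1 / θ) * |corr μ f k δ θ η S x| := by
  have hi := Bdd.ind_nonneg _ (measurableSet_covered (μ := μ) f k δ S) x
  have hc := abs_nonneg (corr μ f k δ θ η S x)
  have hF := abs_nonneg (comp μ S f x)
  have hθ' : 0 < 1 / θ := by positivity
  by_cases h : S ∈ lowSets ι k ∧ Revealed μ f k δ θ η S x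
  · rw [kept_apply_of_revealed h.1 h.2]
    refine (abs_add_le _ _).trans ?_
    rcases h.2 with hcov | ⟨h1, -⟩
    · rw [Bdd.ind_of _ hcov]
      have h3 : |comp μ S f x| ≤ (1 / 2) * (comp μ S f x ^ 2 + 1) := by
        rw [← sq_abs]; nlinarith [sq_nonneg (|comp μ S f x| - 1)]
      nlinarith
    · have h3 : |comp μ S f x| ≤ 1 / θ * |corr μ f k δ θ η S x| := by
        rw [one_div_mul_eq_div, le_div_iff₀ hθ]; linarith
      nlinarith [sq_nonneg (comp μ S f x)]
  · have h0 : kept μ f k δ θ η S x = 0 := by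
      by_cases hS : S ∈ lowSets ι k
      · exact kept_apply_of_not_revealed fun h' => h ⟨hS, h'⟩
      · rw [kept_eq_zero hS]; rfl
    rw [h0, abs_zero]
    positivity

/-- Nothing is lost on a revealed set. On an unrevealed one `F` counts as uncovered energy, and the
correction is below `θ|F|` or below `η`, so `Γ² ≤ θ²F² + η|Γ|`. -/
theorem sq_lost_le (f : Bdd ι X) (k : ℕ) {δ θ η : ℝ} (hη : 0 ≤ η)
    {S : Finset ι} (hS : S ∈ lowSets ι k) (x : ι → X) :
    lost μ f k δ θ η S x ^ 2 ≤ 2 * (comp μ S f x ^ 2 *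
        (1 - Bdd.ind _ (measurableSet_covered (μ := μ) f k δ S) x))
      + 2 * (θ ^ 2 * comp μ S f x ^ 2 + η * |corr μ f k δ θ η S x|) := by
  have hc := abs_nonneg (corr μ f k δ θ η S x)
  have hpos : 0 ≤ θ ^ 2 * comp μ S f x ^ 2 + η * |corr μ f k δ θ η S x| := by positivity
  by_cases h : Revealed μ f k δ θ η S x
  · rw [lost, Bdd.sub_apply, Bdd.add_apply, kept_apply_of_revealed hS h, sub_self]
    have : 0 ≤ 1 - Bdd.ind _ (measurableSet_covered (μ := μ) f k δ S) x := by
      classical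
      rw [Bdd.ind_apply]; split_ifs <;> norm_num
    have := mul_nonneg (sq_nonneg (comp μ S f x)) this
    linarith
  · have hnc : ¬ Covered μ f k δ S x := fun h' => h (Or.inl h')
    have hn2 : ¬ (θ * |comp μ S f x| ≤ |corr μ f k δ θ η S x| ∧ η ≤ |corr μ f k δ θ η S x|) :=
      fun h' => h (Or.inr h')
    rw [lost, Bdd.sub_apply, Bdd.add_apply, kept_apply_of_not_revealed h, Bdd.ind_of_not _ hnc,
      sub_zero, sub_zero, mul_one]
    have hΓ : corr μ f k δ θ η S x ^ 2
        ≤ θ ^ 2 * comp μ S f x ^ 2 + η * |corr μ f k δ θ η S x| := by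
      rw [← sq_abs (corr μ f k δ θ η S x), ← sq_abs (comp μ S f x)]
      have hF := abs_nonneg (comp μ S f x)
      by_cases h1 : θ * |comp μ S f x| ≤ |corr μ f k δ θ η S x|
      · have h2 : |corr μ f k δ θ η S x| < η := not_le.1 fun h' => hn2 ⟨h1, h'⟩
        nlinarith [sq_nonneg (θ * |comp μ S f x|)]
      · have h1' := not_le.1 h1
        have := pow_le_pow_left₀ hc h1'.le 2
        nlinarith
    nlinarith [sq_nonneg (comp μ S f x - corr μ f k δ θ η S x)]

theorem expect_abs_corr_le (f : Bdd ι X) (k : ℕ) (δ θ η : ℝ) (S : Finset ι) :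
    expect μ (corr μ f k δ θ η S).abs
      ≤ ∑ T with S ⊂ T, 2 ^ S.card * expect μ (kept μ f k δ θ η T).abs := by
  calc expect μ (corr μ f k δ θ η S).abs
      ≤ expect μ (∑ T with S ⊂ T, (comp μ S (kept μ f k δ θ η T)).abs) := by
        refine expect_mono fun x => ?_
        rw [Bdd.abs_apply, corr, Bdd.neg_apply, abs_neg, Bdd.sum_apply, Bdd.sum_apply]
        exact Finset.abs_sum_le_sum_abs _ _
    _ ≤ _ := by
        rw [map_sum]
        exact Finset.sum_le_sum fun T _ => expect_abs_comp_le S _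

theorem expect_abs_kept_nonneg (f : Bdd ι X) (k : ℕ) (δ θ η : ℝ) (S : Finset ι) :
    0 ≤ expect μ (kept μ f k δ θ η S).abs := expect_nonneg fun _ => abs_nonneg _

/-- The factor `4 ^ k` bounds `∑ S ⊂ T, 2 ^ S.card`. Strict inclusion moves the right side up to
level `r + 1`, which lets the recursion over levels close. -/
theorem sum_expect_abs_corr_le (f : Bdd ι X) (k : ℕ) (δ θ η : ℝ) {𝒜 : Finset (Finset ι)} {r : ℕ}
    (h𝒜 : ∀ S ∈ 𝒜, r ≤ S.card) :
    ∑ S ∈ 𝒜, expect μ (corr μ f k δ θ η S).abs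
      ≤ 4 ^ k * ∑ T : Finset ι with r + 1 ≤ T.card, expect μ (kept μ f k δ θ η T).abs := by
  calc ∑ S ∈ 𝒜, expect μ (corr μ f k δ θ η S).abs
      ≤ ∑ S ∈ 𝒜, ∑ T with S ⊂ T, 2 ^ S.card * expect μ (kept μ f k δ θ η T).abs :=
        Finset.sum_le_sum fun S _ => expect_abs_corr_le f k δ θ η S
    _ = ∑ T : Finset ι with r + 1 ≤ T.card, ∑ S ∈ 𝒜 with S ⊂ T,
          2 ^ S.card * expect μ (kept μ f k δ θ η T).abs := by
        refine Finset.sum_comm' fun S T => ?_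
        simp only [Finset.mem_filter, Finset.mem_univ, true_and]
        exact ⟨fun ⟨a, b⟩ => ⟨⟨a, b⟩, Nat.succ_le_of_lt ((h𝒜 S a).trans_lt (Finset.card_lt_card b))⟩,
          fun ⟨a, _⟩ => a⟩
    _ ≤ ∑ T : Finset ι with r + 1 ≤ T.card, 4 ^ k * expect μ (kept μ f k δ θ η T).abs := by
        refine Finset.sum_le_sum fun T _ => ?_
        rw [← Finset.sum_mul]
        by_cases hT : T ∈ lowSets ι k
        · refine mul_le_mul_of_nonneg_right (le_trans ?_
            (sum_powerset_two_pow_le (mem_lowSets.1 hT).2)) (expect_abs_kept_nonneg _ _ _ _ _ _)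
          refine Finset.sum_le_sum_of_subset_of_nonneg ?_ fun _ _ _ => by positivity
          intro S hS
          exact Finset.mem_powerset.2 (Finset.mem_filter.1 hS).2.1
        · have : expect μ (kept μ f k δ θ η T).abs = 0 := by
            rw [kept_eq_zero hT]
            have : (0 : Bdd ι X).abs = 0 := by ext x; simp
            rw [this, map_zero]
          rw [this]; simp
    _ = _ := (Finset.mul_sum _ _ _).symm

variable (μ) in
/-- The a priori mass at `S`. -/
noncomputable def baseMass (f : Bdd ι X) (k : ℕ) (δ : ℝ) (S : Finset ι) : ℝ :=
  (1 / 2) * (expect μ (comp μ S f ^ 2) +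
    expect μ (Bdd.ind _ (measurableSet_covered (μ := μ) f k δ S)))

theorem baseMass_nonneg (f : Bdd ι X) (k : ℕ) (δ : ℝ) (S : Finset ι) :
    0 ≤ baseMass μ f k δ S :=
  mul_nonneg (by norm_num) (add_nonneg (expect_nonneg fun _ => sq_nonneg _)
    (expect_nonneg (Bdd.ind_nonneg _ _)))

theorem expect_abs_kept_le (f : Bdd ι X) (k : ℕ) {δ θ η : ℝ} (hθ : 0 < θ) (S : Finset ι) :
    expect μ (kept μ f k δ θ η S).abs
      ≤ baseMass μ f k δ S + (1 + 1 / θ) * expect μ (corr μ f k δ θ η S).abs := by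
  have := expect_mono (μ := μ) (g := (kept μ f k δ θ η S).abs)
    (h := (1 / 2 : ℝ) • (comp μ S f ^ 2 + Bdd.ind _ (measurableSet_covered (μ := μ) f k δ S))
      + (1 + 1 / θ) • (corr μ f k δ θ η S).abs) fun x => by
        rw [Bdd.add_apply, Bdd.smul_apply, Bdd.smul_apply, Bdd.add_apply, Bdd.pow_apply]
        exact abs_kept_le (μ := μ) (η := η) (δ := δ) f k hθ S x
  simpa only [map_add, map_smul, smul_eq_mul, baseMass] using this

/-- Downward induction on the level: corrections at size `r` are fed only by larger sets, so a level
costs one factor `1 + (1 + 1 / θ) * 4 ^ k`. Here `j` is at least the number of levels left before `k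
+ 1`, where nothing is kept. -/
theorem sum_expect_abs_kept_le_pow (f : Bdd ι X) (k : ℕ) {δ θ η : ℝ} (hθ : 0 < θ) (j r : ℕ)
    (hr : k + 1 ≤ r + j) :
    ∑ S : Finset ι with r ≤ S.card, expect μ (kept μ f k δ θ η S).abs
      ≤ (1 + (1 + 1 / θ) * 4 ^ k) ^ j *
        ∑ S ∈ lowSets ι k with r ≤ S.card, baseMass μ f k δ S := by
  have hθ' : 0 < 1 / θ := by positivity
  have hB0 : ∀ r : ℕ, 0 ≤ ∑ S ∈ lowSets ι k with r ≤ S.card, baseMass μ f k δ S := fun r =>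
    Finset.sum_nonneg fun S _ => baseMass_nonneg f k δ S
  have hz : ∀ S ∉ lowSets ι k, expect μ (kept μ f k δ θ η S).abs = 0 := by
    intro S hS
    rw [kept_eq_zero hS]
    have : (0 : Bdd ι X).abs = 0 := by ext x; simp
    rw [this, map_zero]
  induction j generalizing r with
  | zero =>
    rw [pow_zero, one_mul]
    refine le_trans (le_of_eq (Finset.sum_eq_zero fun S hS => hz S fun h => ?_)) (hB0 r)
    have := (Finset.mem_filter.1 hS).2
    have := (mem_lowSets.1 h).2
    omega
  | succ j ih =>
    set a := 1 + (1 + 1 / θ) * 4 ^ k with ha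
    have ha1 : 1 ≤ a := by rw [ha]; have : 0 ≤ (1 + 1 / θ) * 4 ^ k := by positivity
                           linarith
    have ih' := ih (r + 1) (by omega)
    set κ := ∑ S : Finset ι with r + 1 ≤ S.card, expect μ (kept μ f k δ θ η S).abs with hκ
    set B := ∑ S ∈ lowSets ι k with r + 1 ≤ S.card, baseMass μ f k δ S with hB
    have hsplit : (Finset.univ.filter fun S : Finset ι => r ≤ S.card)
        = (Finset.univ.filter fun S : Finset ι => r + 1 ≤ S.card) ∪
          (Finset.univ.filter fun S : Finset ι => S.card = r) := by
      ext S; simp only [Finset.mem_filter, Finset.mem_univ, true_and, Finset.mem_union]; omega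
    have hsplit' : ((lowSets ι k).filter fun S : Finset ι => r ≤ S.card)
        = ((lowSets ι k).filter fun S : Finset ι => r + 1 ≤ S.card) ∪
          ((lowSets ι k).filter fun S : Finset ι => S.card = r) := by
      ext S; simp only [Finset.mem_filter, Finset.mem_union]
      by_cases h : S ∈ lowSets ι k
      · simp only [h, true_and]; omega
      · simp [h]
    have hd : Disjoint (Finset.univ.filter fun S : Finset ι => r + 1 ≤ S.card)
        (Finset.univ.filter fun S : Finset ι => S.card = r) := by
      rw [Finset.disjoint_filter]; intro S _ h; omega
    have hd' : Disjoint ((lowSets ι k).filter fun S : Finset ι => r + 1 ≤ S.card)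
        ((lowSets ι k).filter fun S : Finset ι => S.card = r) := by
      rw [Finset.disjoint_filter]; intro S _ h; omega
    rw [hsplit, Finset.sum_union hd, hsplit', Finset.sum_union hd']
    set b := ∑ S ∈ lowSets ι k with S.card = r, baseMass μ f k δ S with hb
    have hb0 : 0 ≤ b := Finset.sum_nonneg fun S _ => baseMass_nonneg f k δ S
    have hr' : ∑ S : Finset ι with S.card = r, expect μ (kept μ f k δ θ η S).abs
        ≤ b + (1 + 1 / θ) * (4 ^ k * κ) := by
      calc ∑ S : Finset ι with S.card = r, expect μ (kept μ f k δ θ η S).abs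
          = ∑ S ∈ lowSets ι k with S.card = r, expect μ (kept μ f k δ θ η S).abs := by
            refine (Finset.sum_subset (Finset.filter_subset_filter _ (Finset.subset_univ _))
              fun S hS hS' => hz S fun h => ?_).symm
            exact hS' (Finset.mem_filter.2 ⟨h, (Finset.mem_filter.1 hS).2⟩)
        _ ≤ ∑ S ∈ lowSets ι k with S.card = r,
              (baseMass μ f k δ S + (1 + 1 / θ) * expect μ (corr μ f k δ θ η S).abs) :=
            Finset.sum_le_sum fun S _ => expect_abs_kept_le f k hθ S
        _ = b + (1 + 1 / θ) * ∑ S ∈ lowSets ι k with S.card = r,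
              expect μ (corr μ f k δ θ η S).abs := by
            rw [Finset.sum_add_distrib, Finset.mul_sum]
        _ ≤ _ := by
            gcongr
            exact sum_expect_abs_corr_le f k δ θ η fun S hS => (Finset.mem_filter.1 hS).2.ge
    have hpow : 1 ≤ a ^ j := one_le_pow₀ ha1
    calc κ + ∑ S : Finset ι with S.card = r, expect μ (kept μ f k δ θ η S).abs
        ≤ κ + (b + (1 + 1 / θ) * (4 ^ k * κ)) := by gcongr
      _ = a * κ + 1 * b := by rw [ha]; ring
      _ ≤ a * (a ^ j * B) + a ^ (j + 1) * b := by
          gcongr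
          exact one_le_pow₀ ha1
      _ = a ^ (j + 1) * (B + b) := by ring

/-- The total mass of the kept parts. -/
theorem sum_expect_abs_kept_le (f : Bdd ι X) (k : ℕ) {δ θ η : ℝ} (hθ : 0 < θ) :
    ∑ S : Finset ι, expect μ (kept μ f k δ θ η S).abs
      ≤ (1 + (1 + 1 / θ) * 4 ^ k) ^ (k + 1) * ∑ S ∈ lowSets ι k, baseMass μ f k δ S := by
  simpa using sum_expect_abs_kept_le_pow (μ := μ) (δ := δ) (η := η) f k hθ (k + 1) 0 (by omega)

theorem sum_lowSets_expect_abs_corr_le (f : Bdd ι X) (k : ℕ) (δ θ η : ℝ) :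
    ∑ S ∈ lowSets ι k, expect μ (corr μ f k δ θ η S).abs
      ≤ 4 ^ k * ∑ T : Finset ι, expect μ (kept μ f k δ θ η T).abs := by
  refine (sum_expect_abs_corr_le f k δ θ η (r := 0) fun S _ => Nat.zero_le _).trans ?_
  refine mul_le_mul_of_nonneg_left ?_ (by positivity)
  exact Finset.sum_le_sum_of_subset_of_nonneg (Finset.subset_univ _)
    fun T _ _ => expect_abs_kept_nonneg f k δ θ η T

/-- The expected number of revealed sets. -/
theorem sum_expect_revealed_le (f : Bdd ι X) (k : ℕ) (δ θ : ℝ) {η : ℝ} (hη : 0 < η) :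
    ∑ S ∈ lowSets ι k, expect μ (Bdd.ind _ (measurableSet_revealed (μ := μ) f k δ θ η S))
      ≤ ∑ S ∈ lowSets ι k, expect μ (Bdd.ind _ (measurableSet_covered (μ := μ) f k δ S))
        + η⁻¹ * ∑ S ∈ lowSets ι k, expect μ (corr μ f k δ θ η S).abs := by
  rw [Finset.mul_sum, ← Finset.sum_add_distrib]
  refine Finset.sum_le_sum fun S _ => ?_
  rw [← smul_eq_mul, ← map_smul, ← map_add]
  refine expect_mono fun x => ?_
  rw [Bdd.add_apply, Bdd.smul_apply, Bdd.abs_apply]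
  have hc := abs_nonneg (corr μ f k δ θ η S x)
  have h0 := Bdd.ind_nonneg _ (measurableSet_covered (μ := μ) f k δ S) x
  by_cases h : Revealed μ f k δ θ η S x
  · rw [Bdd.ind_of _ h]
    rcases h with h | ⟨-, h⟩
    · rw [Bdd.ind_of _ h]
      have : 0 ≤ η⁻¹ * |corr μ f k δ θ η S x| := by positivity
      linarith
    · have : 1 ≤ η⁻¹ * |corr μ f k δ θ η S x| := by
        rw [inv_mul_eq_div, le_div_iff₀ hη, one_mul]; exact h
      linarith
  · rw [Bdd.ind_of_not _ h]; positivity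

/-- The top components of the lost parts are small in mean square. -/
theorem expect_sq_sum_lost_le (f : Bdd ι X) (k : ℕ) {δ θ η : ℝ} (hη : 0 ≤ η) :
    expect μ ((∑ S ∈ lowSets ι k, comp μ S (lost μ f k δ θ η S)) ^ 2)
      ≤ 2 * ∑ S ∈ lowSets ι k, expect μ (comp μ S f ^ 2 *
            (1 - Bdd.ind _ (measurableSet_covered (μ := μ) f k δ S)))
        + 2 * (θ ^ 2 * ∑ S ∈ lowSets ι k, expect μ (comp μ S f ^ 2)
            + η * ∑ S ∈ lowSets ι k, expect μ (corr μ f k δ θ η S).abs) := by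
  rw [expect_sq_sum fun S _ => isPure_comp S _]
  simp only [Finset.mul_sum, ← Finset.sum_add_distrib]
  refine Finset.sum_le_sum fun S hS => (expect_sq_comp_le S _).trans ?_
  have := expect_mono (μ := μ) (g := lost μ f k δ θ η S ^ 2)
    (h := (2 : ℝ) • (comp μ S f ^ 2 * (1 - Bdd.ind _ (measurableSet_covered (μ := μ) f k δ S)))
      + (2 : ℝ) • ((θ ^ 2) • comp μ S f ^ 2 + η • (corr μ f k δ θ η S).abs)) fun x =>
        sq_lost_le (μ := μ) f k hη hS x
  simpa only [map_add, map_smul, smul_eq_mul] using this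

end Truncation

/-! ### Total influence and the spectral energy. -/

section Influence

variable {ι X : Type*} [Fintype ι] [DecidableEq ι] [MeasurableSpace X]
variable {μ : Measure X} [IsProbabilityMeasure μ]

theorem condE_erase_apply (g : Bdd ι X) (j : ι) (x : ι → X) :
    condE μ (Finset.univ.erase j) g x
      = ∫ z, g (Function.update x j (z j)) ∂(Measure.pi fun _ : ι => μ) := by
  rw [condE_apply_integral]
  refine integral_congr_ae (ae_of_all _ fun z => congrArg g.1 (funext fun i => ?_))
  by_cases h : i = j
  · subst h; simp
  · simp [h]

theorem sub_condE_erase_eq (f : Bdd ι X) (j : ι) :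
    f - condE μ (Finset.univ.erase j) f = ∑ S with j ∈ S, comp μ S f := by
  conv_lhs => rw [← sum_comp_univ (μ := μ) f]
  rw [map_sum, ← Finset.sum_sub_distrib, Finset.sum_filter]
  refine Finset.sum_congr rfl fun S _ => ?_
  split_ifs with h
  · rw [(isPure_comp S f).2 _ fun h' => by simpa using h' h, sub_zero]
  · rw [(isPure_comp S f).condE_self, sub_self]
    intro i hi
    simp only [Finset.mem_erase, Finset.mem_univ, and_true]
    exact fun e => h (e ▸ hi)

/-- The component at `S` survives in `f - E_j f` exactly for the `S.card` coordinates `j ∈ S`. -/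
theorem sum_card_mul_expect_sq_comp (f : Bdd ι X) :
    ∑ S : Finset ι, (S.card : ℝ) * expect μ (comp μ S f ^ 2)
      = ∑ j, expect μ ((f - condE μ (Finset.univ.erase j) f) ^ 2) := by
  have : ∀ j, expect μ ((f - condE μ (Finset.univ.erase j) f) ^ 2)
      = ∑ S with j ∈ S, expect μ (comp μ S f ^ 2) := fun j => by
    rw [sub_condE_erase_eq, expect_sq_sum fun S _ => isPure_comp S f]
  simp only [this, Finset.sum_filter]
  rw [Finset.sum_comm]
  refine Finset.sum_congr rfl fun S _ => ?_
  rw [← Finset.sum_filter]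
  simp

theorem sum_expect_sq_comp (f : Bdd ι X) :
    ∑ S : Finset ι, expect μ (comp μ S f ^ 2) = expect μ (f ^ 2) := by
  conv_rhs => rw [← sum_comp_univ (μ := μ) f]
  rw [expect_sq_sum fun S _ => isPure_comp S f]

theorem abs_sub_condE_le_one {f : Bdd ι X} (hf : IsBoolean (f : (ι → X) → ℝ)) (R : Finset ι)
    (x : ι → X) : |(f - condE μ R f : Bdd ι X) x| ≤ 1 := by
  have h0 : ∀ y, 0 ≤ f y := fun y => by rcases hf y with h | h <;> simp [h]
  have h1 : ∀ y, f y ≤ 1 := fun y => by rcases hf y with h | h <;> simp [h]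
  have h2 := condE_nonneg (μ := μ) (R := R) h0 x
  have h3 := condE_le_const (μ := μ) (R := R) h1 x
  rw [Bdd.sub_apply, abs_le]
  constructor <;> linarith [h0 x, h1 x]

/-- The absolute value is moved inside the average over the fresh coordinate; for Boolean `f` the
absolute difference is the indicator of a change. -/
theorem expect_abs_sub_condE_le_influence {n : ℕ} {f : Bdd (Fin n) X}
    (hf : IsBoolean (f : (Fin n → X) → ℝ)) (j : Fin n) :
    expect μ (f - condE μ (Finset.univ.erase j) f).abs ≤ influence μ f j := by
  classical
  set P : Measure (Fin n → X) := Measure.pi fun _ : Fin n => μ with hP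
  set s : Set ((Fin n → X) × X) := {p | f p.1 ≠ f (Function.update p.1 j p.2)} with hs
  have hsm : MeasurableSet s := by
    refine (measurableSet_eq_fun (f.measurable.comp measurable_fst) (f.measurable.comp ?_)).compl
    exact measurable_update'.comp (measurable_fst.prodMk measurable_snd)
  -- `condE` resamples a whole point and uses only its `j`-th coordinate, so the event of
  -- `influence` is pulled back along evaluation at `j`.
  have hmp : MeasurePreserving (Prod.map id (Function.eval j)) (P.prod P) (P.prod μ) :=
    (MeasurePreserving.id P).prod (measurePreserving_eval (fun _ : Fin n => μ) j)
  set s' : Set ((Fin n → X) × (Fin n → X)) := Prod.map id (Function.eval j) ⁻¹' s with hs'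
  have hsm' : MeasurableSet s' := hmp.measurable hsm
  have hint : Integrable (s'.indicator fun _ => (1 : ℝ)) (P.prod P) :=
    (integrable_const _).indicator hsm'
  have hinf : influence μ f j = ∫ x, ∫ z, s'.indicator (fun _ => (1 : ℝ)) (x, z) ∂P ∂P := by
    rw [← integral_prod _ hint]
    change (P.prod μ).real s = ∫ z, s'.indicator (fun _ => (1 : ℝ)) z ∂P.prod P
    rw [integral_indicator_const _ hsm', smul_eq_mul, mul_one, measureReal_def, measureReal_def,
      hmp.measure_preimage hsm.nullMeasurableSet]
  rw [hinf, expect_apply]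
  refine integral_mono (Bdd.integrable _ _) hint.integral_prod_left fun x => ?_
  have hg : Measurable fun z : Fin n → X => f (Function.update x j (z j)) :=
    f.measurable.comp ((measurable_update x).comp (measurable_pi_apply j))
  have hb : Integrable (fun z : Fin n → X => f (Function.update x j (z j))) P := by
    obtain ⟨C, hC⟩ := f.exists_bound
    exact Integrable.of_bound hg.aestronglyMeasurable C (ae_of_all _ fun z => hC _)
  have e : (f - condE μ (Finset.univ.erase j) f : Bdd (Fin n) X) x
      = ∫ z, (f x - f (Function.update x j (z j))) ∂P := by
    rw [Bdd.sub_apply, condE_erase_apply, integral_sub (integrable_const _) hb, integral_const,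
      probReal_univ, one_smul]
  rw [Bdd.abs_apply, e]
  refine abs_integral_le_integral_abs.trans_eq (integral_congr_ae (ae_of_all _ fun z => ?_))
  by_cases h : f x = f (Function.update x j (z j))
  · have : (x, z) ∉ s' := fun h' => h' h
    simp only [Set.indicator_of_notMem this, ← h, sub_self, abs_zero]
  · have : (x, z) ∈ s' := h
    simp only [Set.indicator_of_mem this]
    rcases hf x with h1 | h1 <;> rcases hf (Function.update x j (z j)) with h2 | h2 <;>
      rw [h1, h2] at h ⊢ <;> simp_all

theorem sum_card_mul_le_totalInfluence {n : ℕ} {f : Bdd (Fin n) X}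
    (hf : IsBoolean (f : (Fin n → X) → ℝ)) :
    ∑ S : Finset (Fin n), (S.card : ℝ) * expect μ (comp μ S f ^ 2) ≤ totalInfluence μ f := by
  rw [sum_card_mul_expect_sq_comp, totalInfluence]
  refine Finset.sum_le_sum fun j _ => le_trans (expect_mono fun x => ?_)
    (expect_abs_sub_condE_le_influence hf j)
  rw [Bdd.pow_apply, Bdd.abs_apply, ← sq_abs, sq]
  exact mul_le_of_le_one_left (abs_nonneg _) (abs_sub_condE_le_one hf _ x)

end Influence

/-! ### From kept parts to a pseudo-junta. -/

section Junta

variable {X : Type*} [MeasurableSpace X] {n : ℕ}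

/-- Extend a point of `X^S` by a constant. -/
def extendBy {ι : Type*} [DecidableEq ι] (x₀ : X) (S : Finset ι) (z : S → X) : ι → X :=
  fun i => if h : i ∈ S then z ⟨i, h⟩ else x₀

theorem measurable_extendBy {ι : Type*} [DecidableEq ι] (x₀ : X) (S : Finset ι) :
    Measurable (extendBy x₀ S) := by
  refine measurable_pi_lambda _ fun i => ?_
  by_cases h : i ∈ S
  · simpa only [extendBy, h, dif_pos] using measurable_pi_apply _
  · simpa only [extendBy, h, dif_neg, not_false_eq_true] using measurable_const

theorem extendBy_restrict {ι : Type*} [DecidableEq ι] (x₀ : X) {S : Finset ι} (x : ι → X) {i : ι}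
    (h : i ∈ S) : extendBy x₀ S (S.restrict x) i = x i := by
  simp [extendBy, h]

theorem measurable_sigma {α β : Type*} {γ : α → Type*} [∀ a, MeasurableSpace (γ a)]
    [MeasurableSpace β] {g : Sigma γ → β} (hg : ∀ a, Measurable fun z => g ⟨a, z⟩) :
    Measurable g := fun _ ht =>
  MeasurableSpace.measurableSet_iInf.2 fun a => hg a ht

variable {μ : Measure X} [IsProbabilityMeasure μ]

/-- A function that is approximated by a constant and the kept parts is approximated by the
pseudo-junta which looks at the revealed sets. -/
theorem exists_pseudoJunta_of_kept {f : Bdd (Fin n) X} (hf : IsBoolean (f : (Fin n → X) → ℝ))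
    (g : Bdd (Fin n) X) (k : ℕ) (δ θ η c ε K : ℝ)
    (hA : expect μ ((f - (c • 1 + ∑ S ∈ lowSets (Fin n) k, kept μ g k δ θ η S)) ^ 2) ≤ ε / 4)
    (hK : k * ∑ S ∈ lowSets (Fin n) k,
      expect μ (Bdd.ind _ (measurableSet_revealed (μ := μ) g k δ θ η S)) ≤ K) :
    ∃ h : (Fin n → X) → ℝ, IsPseudoJunta μ K h ∧
      eLpNorm ((f : (Fin n → X) → ℝ) - h) 1 (Measure.pi fun _ : Fin n => μ)
        ≤ ENNReal.ofReal ε := by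
  classical
  -- Fills in unseen coordinates; its value is irrelevant since everything evaluated at the extended
  -- point depends only on the seen ones.
  obtain ⟨x₀⟩ : Nonempty X := μ.nonempty_of_neZero
  set A : Bdd (Fin n) X := c • 1 + ∑ S ∈ lowSets (Fin n) k, kept μ g k δ θ η S with hAdef
  let h : (Fin n → X) → ℝ := fun x => if 1 / 2 ≤ A x then 1 else 0
  let J : (S : Finset (Fin n)) → (S → X) → Bool := fun S z =>
    decide (S ∈ lowSets (Fin n) k ∧ Revealed μ g k δ θ η S (extendBy x₀ S z))
  have hJ : ∀ S x, J S (S.restrict x) = true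
      ↔ S ∈ lowSets (Fin n) k ∧ Revealed μ g k δ θ η S x := fun S x => by
    simp only [J, decide_eq_true_eq]
    rw [dependsOn_revealed g k δ θ η S (fun i hi => extendBy_restrict x₀ x hi)]
  have hsel : ∀ S x, S ∈ lowSets (Fin n) k → Revealed μ g k δ θ η S x → S ⊆ selected J x := by
    intro S x hS hr
    exact Finset.subset_biUnion_of_mem id (Finset.mem_filter.2 ⟨Finset.mem_univ _,
      (hJ S x).2 ⟨hS, hr⟩⟩)
  have hmeas : Measurable h := Measurable.ite (measurableSet_le measurable_const A.measurable)
    measurable_const measurable_const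
  refine ⟨h, ⟨fun x => ?_, J, fun S => ?_, ?_, ?_⟩, ?_⟩
  · simp only [h]; split_ifs <;> simp
  · refine measurable_to_bool ?_
    have : J S ⁻¹' {true} = {z | S ∈ lowSets (Fin n) k} ∩
        (extendBy x₀ S ⁻¹' {x | Revealed μ g k δ θ η S x}) := by
      ext z; simp [J]
    rw [this]
    exact (MeasurableSet.const _).inter
      (measurable_extendBy x₀ S (measurableSet_revealed g k δ θ η S))
  -- The sum may run over all low sets inside the selected set: unrevealed ones contribute zero, and
  -- every revealed low set lies inside.
  · let H : ((S : Finset (Fin n)) × (S → X)) → ℝ := fun p =>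
      if 1 / 2 ≤ c + ∑ S ∈ lowSets (Fin n) k with S ⊆ p.1,
        kept μ g k δ θ η S (extendBy x₀ p.1 p.2) then 1 else 0
    have hH : Measurable H := by
      refine measurable_sigma fun C => ?_
      have hsum : Measurable fun z : C → X => ∑ S ∈ lowSets (Fin n) k with S ⊆ C,
          kept μ g k δ θ η S (extendBy x₀ C z) := Finset.measurable_sum _ fun S _ =>
        (kept μ g k δ θ η S).measurable.comp (measurable_extendBy x₀ C)
      exact Measurable.ite (measurableSet_le measurable_const (measurable_const.add hsum))
        measurable_const measurable_const
    have : h = H ∘ reveal J := by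
      ext x
      have e : A x = c + ∑ S ∈ lowSets (Fin n) k with S ⊆ selected J x,
          kept μ g k δ θ η S (extendBy x₀ (selected J x) ((selected J x).restrict x)) := by
        rw [hAdef, Bdd.add_apply, Bdd.smul_apply, Bdd.one_apply, mul_one, Bdd.sum_apply,
          Finset.sum_filter]
        congr 1
        refine Finset.sum_congr rfl fun S hS => ?_
        split_ifs with hC
        · exact (dependsOn_kept g k δ θ η S fun i hi => extendBy_restrict x₀ x (hC hi)).symm
        · exact kept_apply_of_not_revealed fun hr => hC (hsel S x hS hr)
      simp only [h, H, reveal, Function.comp, e]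
    rw [this]
    exact hH.comp (comap_measurable _)
  · have hcard : ∀ x, ((selected J x).card : ℝ) ≤ ((k : ℝ) • ∑ S ∈ lowSets (Fin n) k,
        Bdd.ind _ (measurableSet_revealed (μ := μ) g k δ θ η S) : Bdd (Fin n) X) x := by
      intro x
      rw [Bdd.smul_apply, Bdd.sum_apply, Finset.mul_sum]
      have h1 : (selected J x).card
          ≤ ∑ S with J S (S.restrict x) = true, S.card := Finset.card_biUnion_le
      have h2 : (Finset.univ.filter fun S : Finset (Fin n) => J S (S.restrict x) = true)
          = (lowSets (Fin n) k).filter fun S => Revealed μ g k δ θ η S x := by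
        ext S; simp [hJ]
      rw [h2, Finset.sum_filter] at h1
      calc ((selected J x).card : ℝ)
          ≤ ((∑ S ∈ lowSets (Fin n) k, if Revealed μ g k δ θ η S x then S.card else 0 : ℕ) : ℝ) :=
            by exact_mod_cast h1
        _ ≤ _ := by
            rw [Nat.cast_sum]
            refine Finset.sum_le_sum fun S hS => ?_
            by_cases hr : Revealed μ g k δ θ η S x
            · rw [if_pos hr, Bdd.ind_of _ hr, mul_one]
              exact_mod_cast (mem_lowSets.1 hS).2
            · rw [if_neg hr, Bdd.ind_of_not _ hr]; simp
    set B : Bdd (Fin n) X := (k : ℝ) • ∑ S ∈ lowSets (Fin n) k,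
        Bdd.ind _ (measurableSet_revealed (μ := μ) g k δ θ η S) with hB
    calc ∫⁻ x, ((selected J x).card : ENNReal) ∂(Measure.pi fun _ : Fin n => μ)
        ≤ ∫⁻ x, ENNReal.ofReal (B x) ∂(Measure.pi fun _ : Fin n => μ) := by
          refine lintegral_mono fun x => ?_
          rw [← ENNReal.ofReal_natCast]
          exact ENNReal.ofReal_le_ofReal (hcard x)
      _ = ENNReal.ofReal (expect μ B) := by
          rw [expect_apply, ofReal_integral_eq_lintegral_ofReal (B.integrable _)]
          exact ae_of_all _ fun x => (Nat.cast_nonneg _).trans (hcard x)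
      _ ≤ ENNReal.ofReal K := by
          refine ENNReal.ofReal_le_ofReal ?_
          rw [hB, map_smul, map_sum, smul_eq_mul]
          exact hK
  · rw [eLpNorm_one_eq_lintegral_enorm]
    calc ∫⁻ x, ‖((f : (Fin n → X) → ℝ) - h) x‖ₑ ∂(Measure.pi fun _ : Fin n => μ)
        ≤ ∫⁻ x, ENNReal.ofReal (((4 : ℝ) • (f - A) ^ 2 : Bdd (Fin n) X) x)
            ∂(Measure.pi fun _ : Fin n => μ) := by
          -- Rounding at 1/2 errs only where `|f - A| ≥ 1/2`, so `|f - h| ≤ 4 (f - A)²`.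
          refine lintegral_mono fun x => ?_
          rw [Real.enorm_eq_ofReal_abs]
          refine ENNReal.ofReal_le_ofReal ?_
          rw [Pi.sub_apply, Bdd.smul_apply, Bdd.pow_apply, Bdd.sub_apply]
          simp only [h]
          rcases hf x with h0 | h0 <;> rw [h0] <;> split_ifs with h1
          · norm_num; nlinarith
          · norm_num; positivity
          · norm_num; positivity
          · norm_num; nlinarith
      _ = ENNReal.ofReal (expect μ ((4 : ℝ) • (f - A) ^ 2)) := by
          rw [expect_apply, ofReal_integral_eq_lintegral_ofReal (Bdd.integrable _ _)]
          refine ae_of_all _ fun x => ?_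
          change 0 ≤ 4 * (f - A : Bdd (Fin n) X) x ^ 2
          positivity
      _ ≤ ENNReal.ofReal ε := by
          refine ENNReal.ofReal_le_ofReal ?_
          rw [map_smul, smul_eq_mul]
          linarith

end Junta

/-! ### Error estimate and choice of parameters. -/

section Main

variable {X : Type*} [MeasurableSpace X] {n : ℕ} {μ : Measure X} [IsProbabilityMeasure μ]

theorem abs_le_one_of_isBoolean {f : Bdd (Fin n) X} (hf : IsBoolean (f : (Fin n → X) → ℝ))
    (x : Fin n → X) : |f x| ≤ 1 := by
  rcases hf x with h | h <;> simp [h]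

theorem expect_sq_le_one {f : Bdd (Fin n) X} (hf : IsBoolean (f : (Fin n → X) → ℝ)) :
    expect μ (f ^ 2) ≤ 1 := by
  rw [← expect_one (μ := μ) (ι := Fin n) (X := X)]
  refine expect_mono fun x => ?_
  rcases hf x with h | h <;> simp [h]

theorem sum_lowSets_expect_sq_comp_le {f : Bdd (Fin n) X}
    (hf : IsBoolean (f : (Fin n → X) → ℝ)) (k : ℕ) :
    ∑ S ∈ lowSets (Fin n) k, expect μ (comp μ S f ^ 2) ≤ 1 := by
  refine le_trans ?_ (expect_sq_le_one (μ := μ) hf)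
  rw [← sum_expect_sq_comp]
  exact Finset.sum_le_sum_of_subset_of_nonneg (Finset.subset_univ _)
    fun S _ _ => expect_nonneg fun x => sq_nonneg _

theorem totalInfluence_nonneg (f : (Fin n → X) → ℝ) : 0 ≤ totalInfluence μ f :=
  Finset.sum_nonneg fun _ _ => measureReal_nonneg

/-- The energy of degree above `k` is controlled by the total influence. -/
theorem mul_expect_sq_high_le {f : Bdd (Fin n) X} (hf : IsBoolean (f : (Fin n → X) → ℝ))
    (k : ℕ) :
    ((k : ℝ) + 1) * expect μ ((∑ S : Finset (Fin n) with k < S.card, comp μ S f) ^ 2)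
      ≤ totalInfluence μ f := by
  refine le_trans ?_ (sum_card_mul_le_totalInfluence (μ := μ) hf)
  rw [expect_sq_sum fun S _ => isPure_comp S f, Finset.mul_sum]
  have h0 : ∀ S : Finset (Fin n), 0 ≤ expect μ (comp μ S f ^ 2) :=
    fun S => expect_nonneg fun x => sq_nonneg _
  refine le_trans (Finset.sum_le_sum fun S hS => ?_) (Finset.sum_le_sum_of_subset_of_nonneg
    (Finset.filter_subset (fun S : Finset (Fin n) => k < S.card) Finset.univ)
    fun S _ _ => mul_nonneg (Nat.cast_nonneg _) (h0 S))
  refine mul_le_mul_of_nonneg_right ?_ (h0 S)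
  exact_mod_cast (Finset.mem_filter.1 hS).2

theorem eq_expect_add_low_add_high (f : Bdd (Fin n) X) (k : ℕ) :
    f = expect μ f • 1 + ∑ S ∈ lowSets (Fin n) k, comp μ S f
      + ∑ S : Finset (Fin n) with k < S.card, comp μ S f := by
  have hu : (Finset.univ : Finset (Finset (Fin n)))
      = insert ∅ (lowSets (Fin n) k ∪ Finset.univ.filter fun S => k < S.card) := by
    ext S
    simp only [Finset.mem_univ, Finset.mem_insert, Finset.mem_union, mem_lowSets,
      Finset.mem_filter, true_and, true_iff]
    by_cases h : S = ∅
    · exact Or.inl h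
    · exact Or.inr ((le_or_gt S.card k).imp (fun h' => ⟨Finset.nonempty_iff_ne_empty.2 h, h'⟩) id)
  have h1 : (∅ : Finset (Fin n)) ∉ lowSets (Fin n) k ∪ Finset.univ.filter fun S => k < S.card := by
    simp [mem_lowSets]
  have h2 : Disjoint (lowSets (Fin n) k) (Finset.univ.filter fun S => k < S.card) := by
    rw [Finset.disjoint_left]
    intro S hS hS'
    exact absurd (mem_lowSets.1 hS).2 (not_le.2 (Finset.mem_filter.1 hS').2)
  conv_lhs => rw [← sum_comp_univ (μ := μ) f, hu, Finset.sum_insert h1, Finset.sum_union h2,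
    comp_empty, ← add_assoc]

/-- The mean square error of the approximation by the kept parts. -/
theorem expect_sq_sub_kept_le {f : Bdd (Fin n) X} (hf : IsBoolean (f : (Fin n → X) → ℝ)) (k : ℕ)
    {δ l θ η : ℝ} (hδ : 0 < δ) (hl : 0 < l) (hδl : 2 * 2 ^ (11 * k) * δ ≤ l ^ 3) (hη : 0 ≤ η) :
    expect μ ((f - ((expect μ f - ∑ S ∈ lowSets (Fin n) k, expect μ (kept μ f k δ θ η S)) • 1
        + ∑ S ∈ lowSets (Fin n) k, kept μ f k δ θ η S)) ^ 2)
      ≤ 2 * (totalInfluence μ f / (k + 1)) + 2 * (4 * l * totalInfluence μ f + 2 * θ ^ 2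
        + 2 * η * (4 ^ k * ∑ S, expect μ (kept μ f k δ θ η S).abs)) := by
  set e1 : Bdd (Fin n) X := ∑ S : Finset (Fin n) with k < S.card, comp μ S f with he1
  set e2 : Bdd (Fin n) X := ∑ S ∈ lowSets (Fin n) k, comp μ S (lost μ f k δ θ η S) with he2
  -- The constant absorbs the means of the kept parts; what remains is the high-degree part and the
  -- projected lost parts.
  have hdec : f - ((expect μ f - ∑ S ∈ lowSets (Fin n) k, expect μ (kept μ f k δ θ η S)) • 1
        + ∑ S ∈ lowSets (Fin n) k, kept μ f k δ θ η S) = e1 + e2 := by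
    have h := eq_expect_add_low_add_high (μ := μ) f k
    rw [sum_comp_eq_kept_add_lost f k δ θ η, Finset.sum_sub_distrib, ← Finset.sum_smul] at h
    rw [sub_eq_iff_eq_add]
    refine h.trans ?_
    rw [sub_smul]
    abel
  have h1 : expect μ (e1 ^ 2) ≤ totalInfluence μ f / (k + 1) := by
    rw [le_div_iff₀ (by positivity), mul_comm]
    exact mul_expect_sq_high_le hf k
  have h2 : expect μ (e2 ^ 2) ≤ 4 * l * totalInfluence μ f + 2 * θ ^ 2
        + 2 * η * (4 ^ k * ∑ S, expect μ (kept μ f k δ θ η S).abs) := by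
    have hu : ∑ S ∈ lowSets (Fin n) k, expect μ (comp μ S f ^ 2 *
        (1 - Bdd.ind _ (measurableSet_covered (μ := μ) f k δ S))) ≤ 2 * l * totalInfluence μ f := by
      refine (sum_expect_not_covered_le f k hδ hl hδl
        fun i => abs_sub_condE_le_one hf _).trans ?_
      rw [totalInfluence]
      gcongr with j _
      exact expect_abs_sub_condE_le_influence hf j
    have hs := sum_lowSets_expect_sq_comp_le (μ := μ) hf k
    have hc := sum_lowSets_expect_abs_corr_le (μ := μ) f k δ θ η
    have hθ2 := mul_le_mul_of_nonneg_left hs (sq_nonneg θ)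
    have hηc := mul_le_mul_of_nonneg_left hc hη
    have := expect_sq_sum_lost_le (μ := μ) (δ := δ) (θ := θ) f k hη
    linarith
  rw [hdec]
  have h3 : expect μ ((e1 + e2) ^ 2) ≤ expect μ ((2 : ℝ) • e1 ^ 2 + (2 : ℝ) • e2 ^ 2) := by
    refine expect_mono fun x => ?_
    simp only [Bdd.pow_apply, Bdd.add_apply, Bdd.smul_apply]
    nlinarith [sq_nonneg (e1 x - e2 x)]
  rw [map_add, map_smul, map_smul, smul_eq_mul, smul_eq_mul] at h3
  linarith

theorem natCast_add_one_le_two_pow (k : ℕ) : (k : ℝ) + 1 ≤ 2 ^ k := by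
  exact_mod_cast Nat.succ_le_of_lt k.lt_two_pow_self

/-- The total mass of the kept parts, for parameters that are inverse powers of two. -/
theorem sum_expect_abs_kept_le_two_pow {f : Bdd (Fin n) X}
    (hf : IsBoolean (f : (Fin n → X) → ℝ)) {k : ℕ} (hk : 1 ≤ k) {δ θ η : ℝ} (hδ : 0 < δ)
    (hδk : 64 ^ k / δ ≤ 2 ^ (33 * k)) (hθ : 0 < θ) (hθk : 1 / θ ≤ 2 ^ (4 * k)) :
    (∑ S ∈ lowSets (Fin n) k, expect μ (Bdd.ind _ (measurableSet_covered (μ := μ) f k δ S))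
        ≤ 2 ^ (34 * k ^ 2)) ∧
      ∑ S, expect μ (kept μ f k δ θ η S).abs ≤ 2 ^ (50 * k ^ 2) := by
  have hk2 : k ≤ k ^ 2 := by nlinarith
  have h2 : (1 : ℝ) ≤ 2 := by norm_num
  have hM : ∑ S ∈ lowSets (Fin n) k,
      expect μ (Bdd.ind _ (measurableSet_covered (μ := μ) f k δ S)) ≤ 2 ^ (34 * k ^ 2) := by
    calc _ ≤ ∑ j ∈ Finset.range (k + 1), (64 ^ k / δ) ^ j :=
          sum_expect_covered_le (abs_le_one_of_isBoolean hf) hδ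
      _ ≤ ∑ j ∈ Finset.range (k + 1), (2 : ℝ) ^ (33 * k ^ 2) := by
          refine Finset.sum_le_sum fun j hj => ?_
          calc (64 ^ k / δ) ^ j ≤ (2 ^ (33 * k)) ^ j := by gcongr
            _ = 2 ^ (33 * k * j) := (pow_mul _ _ _).symm
            _ ≤ 2 ^ (33 * k ^ 2) := by
                refine pow_le_pow_right₀ h2 ?_
                have := Finset.mem_range.1 hj
                nlinarith
      _ = (k + 1) * 2 ^ (33 * k ^ 2) := by simp
      _ ≤ 2 ^ k * 2 ^ (33 * k ^ 2) := by gcongr; exact natCast_add_one_le_two_pow k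
      _ = 2 ^ (k + 33 * k ^ 2) := (pow_add _ _ _).symm
      _ ≤ 2 ^ (34 * k ^ 2) := pow_le_pow_right₀ h2 (by omega)
  refine ⟨hM, ?_⟩
  have hB : ∑ S ∈ lowSets (Fin n) k, baseMass μ f k δ S ≤ 2 ^ (34 * k ^ 2) := by
    simp only [baseMass]
    rw [← Finset.mul_sum, Finset.sum_add_distrib]
    have h1 := sum_lowSets_expect_sq_comp_le (μ := μ) hf k
    have h3 : (1 : ℝ) ≤ 2 ^ (34 * k ^ 2) := one_le_pow₀ h2
    linarith
  have ha : 1 + (1 + 1 / θ) * 4 ^ k ≤ 2 ^ (8 * k) := by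
    have h1 : (1 : ℝ) ≤ 2 ^ (4 * k) := one_le_pow₀ h2
    have h4 : (4 : ℝ) ^ k = 2 ^ (2 * k) := by rw [pow_mul]; norm_num
    have h5 : (1 : ℝ) ≤ 2 ^ (7 * k) := one_le_pow₀ h2
    have h6 : (2 : ℝ) ≤ 2 ^ k := by
      calc (2 : ℝ) = 2 ^ 1 := (pow_one _).symm
        _ ≤ 2 ^ k := pow_le_pow_right₀ h2 hk
    calc 1 + (1 + 1 / θ) * 4 ^ k ≤ 2 ^ (7 * k) + (2 * 2 ^ (4 * k)) * 2 ^ (2 * k) := by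
          rw [h4]; gcongr; linarith
      _ ≤ 2 ^ (7 * k) + (2 ^ k * 2 ^ (4 * k)) * 2 ^ (2 * k) := by gcongr
      _ = 2 * 2 ^ (7 * k) := by rw [← pow_add, ← pow_add]; ring_nf
      _ ≤ 2 ^ k * 2 ^ (7 * k) := by gcongr
      _ = 2 ^ (8 * k) := by rw [← pow_add]; ring_nf
  calc ∑ S, expect μ (kept μ f k δ θ η S).abs
      ≤ (1 + (1 + 1 / θ) * 4 ^ k) ^ (k + 1) * ∑ S ∈ lowSets (Fin n) k, baseMass μ f k δ S :=
        sum_expect_abs_kept_le f k hθ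
    _ ≤ (2 ^ (8 * k)) ^ (k + 1) * 2 ^ (34 * k ^ 2) := by
        gcongr
        exact Finset.sum_nonneg fun S _ => baseMass_nonneg f k δ S
    _ = 2 ^ (8 * k * (k + 1) + 34 * k ^ 2) := by rw [← pow_mul, ← pow_add]
    -- Here `8k(k + 1) ≤ 16k²`, as `k ≥ 1`.
    _ ≤ 2 ^ (50 * k ^ 2) := pow_le_pow_right₀ h2 (by nlinarith)

theorem exists_pseudoJunta_of_lt_one {f : Bdd (Fin n) X} (hf : IsBoolean (f : (Fin n → X) → ℝ))
    {ε L : ℝ} (hε : 0 < ε) (hε1 : ε < 1) (hL : 1 ≤ L) (hI : totalInfluence μ f ≤ L) :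
    ∃ h : (Fin n → X) → ℝ, IsPseudoJunta μ (Real.exp (10 ^ 15 * (L / ε) ^ 3)) h ∧
      eLpNorm ((f : (Fin n → X) → ℝ) - h) 1 (Measure.pi fun _ : Fin n => μ)
        ≤ ENNReal.ofReal ε := by
  have hI0 := totalInfluence_nonneg (μ := μ) (f : (Fin n → X) → ℝ)
  have hL0 : 0 < L := by linarith
  set m : ℝ := L / ε with hm
  have hm1 : 1 ≤ m := by rw [hm, le_div_iff₀ hε]; linarith
  have hεm : 1 / ε ≤ m := by rw [hm]; gcongr
  -- Makes the high-degree energy at most `ε / 16`.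
  set k : ℕ := ⌈16 * m⌉₊ with hk
  have hk16 : 16 * m ≤ k := Nat.le_ceil _
  have hk17 : (k : ℝ) ≤ 17 * m := by
    have := Nat.ceil_lt_add_one (show 0 ≤ 16 * m by positivity)
    linarith
  have hk1 : 1 ≤ k := by
    have : (1 : ℝ) ≤ k := by linarith
    exact_mod_cast this
  have hkpos : (0 : ℝ) < k := by exact_mod_cast hk1
  have h2 : (1 : ℝ) ≤ 2 := by norm_num
  have hk2 : k ≤ k ^ 2 := by nlinarith
  have hkp : (k : ℝ) ≤ 2 ^ k := by linarith [natCast_add_one_le_two_pow k]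
  have h2k : (2 : ℝ) ≤ 2 ^ k := by
    calc (2 : ℝ) = 2 ^ 1 := (pow_one _).symm
      _ ≤ 2 ^ k := pow_le_pow_right₀ h2 hk1
  -- Makes the uncovered contribution `4 * l * I` at most `ε / 64`.
  set l : ℝ := ε / (256 * L) with hl
  have hl0 : 0 < l := by positivity
  have hlinv : l⁻¹ ≤ 2 ^ (5 * k) := by
    have h1 : l⁻¹ = 256 * m := by rw [hl, inv_div, hm, mul_div_assoc]
    calc l⁻¹ ≤ 16 * k := by rw [h1]; linarith
      _ ≤ (2 ^ k) ^ 4 * 2 ^ k := by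
          gcongr
          calc (16 : ℝ) = 2 ^ 4 := by norm_num
            _ ≤ (2 ^ k) ^ 4 := by gcongr
      _ = 2 ^ (5 * k) := by rw [← pow_mul, ← pow_add]; ring_nf
  -- The largest threshold for which the fourth-moment term can be absorbed.
  set δ : ℝ := l ^ 3 / (2 * 2 ^ (11 * k)) with hδ
  have hδ0 : 0 < δ := by positivity
  have hδl : 2 * 2 ^ (11 * k) * δ ≤ l ^ 3 := by
    rw [hδ, mul_div_cancel₀ _ (by positivity)]
  have hδk : 64 ^ k / δ ≤ 2 ^ (33 * k) := by
    have h64 : (64 : ℝ) ^ k = 2 ^ (6 * k) := by rw [pow_mul]; norm_num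
    calc 64 ^ k / δ = 2 ^ (6 * k) * (2 * 2 ^ (11 * k)) * l⁻¹ ^ 3 := by
          rw [h64, hδ, inv_pow]; field_simp
      _ ≤ 2 ^ (6 * k) * (2 ^ k * 2 ^ (11 * k)) * (2 ^ (5 * k)) ^ 3 := by gcongr
      _ = 2 ^ (33 * k) := by rw [← pow_mul, ← pow_add, ← pow_add, ← pow_add]; ring_nf
  set θ : ℝ := ε / 128 with hθ
  have hθ0 : 0 < θ := by positivity
  have hθk : 1 / θ ≤ 2 ^ (4 * k) := by
    have h1 : 1 / θ = 128 * (1 / ε) := by rw [hθ]; field_simp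
    calc 1 / θ ≤ 8 * k := by rw [h1]; linarith
      _ ≤ (2 ^ k) ^ 3 * 2 ^ k := by
          gcongr
          calc (8 : ℝ) = 2 ^ 3 := by norm_num
            _ ≤ (2 ^ k) ^ 3 := by gcongr
      _ = 2 ^ (4 * k) := by rw [← pow_mul, ← pow_add]; ring_nf
  set κ : ℝ := 2 ^ (50 * k ^ 2) with hκ
  have hκ0 : 0 < κ := by positivity
  -- Balances the bound `4 ^ k * κ` on the total correction, so that its contribution is `ε / 64`.
  set η : ℝ := ε / (128 * (4 ^ k * κ)) with hη
  have hη0 : 0 < η := by positivity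
  obtain ⟨hM, hkept⟩ := sum_expect_abs_kept_le_two_pow (μ := μ) (η := η) hf hk1 hδ0 hδk hθ0 hθk
  refine exists_pseudoJunta_of_kept hf f k δ θ η _ ε _
    ((expect_sq_sub_kept_le hf k hδ0 hl0 hδl hη0.le).trans ?_) ?_
  · have t1 : totalInfluence μ f / (k + 1) ≤ ε / 16 := by
      rw [div_le_iff₀ (by positivity)]
      have : 16 * L ≤ k * ε := by
        rw [hm, ← mul_div_assoc, div_le_iff₀ hε] at hk16; exact hk16
      nlinarith
    have t2 : 4 * l * totalInfluence μ f ≤ ε / 64 := by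
      calc 4 * l * totalInfluence μ f ≤ 4 * l * L := by gcongr
        _ = ε / 64 := by rw [hl]; field_simp; norm_num
    have t3 : 2 * θ ^ 2 ≤ ε / 64 := by rw [hθ]; nlinarith
    have t4 : 2 * η * (4 ^ k * ∑ S, expect μ (kept μ f k δ θ η S).abs) ≤ ε / 64 := by
      calc 2 * η * (4 ^ k * ∑ S, expect μ (kept μ f k δ θ η S).abs)
          ≤ 2 * η * (4 ^ k * κ) := by gcongr
        _ = ε / 64 := by rw [hη]; field_simp; norm_num
    -- The total is `2 · ε/16 + 2 · 3 · ε/64 = 7ε/32 ≤ ε/4`.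
    linarith
  · have hcorr : ∑ S ∈ lowSets (Fin n) k, expect μ (corr μ f k δ θ η S).abs ≤ 4 ^ k * κ :=
      (sum_lowSets_expect_abs_corr_le f k δ θ η).trans (by gcongr)
    have h4 : (4 : ℝ) ^ k = 2 ^ (2 * k) := by rw [pow_mul]; norm_num
    have hηinv : η⁻¹ * (4 ^ k * κ) ≤ 2 ^ (108 * k ^ 2) := by
      have h1 : η⁻¹ = 1 / θ * (4 ^ k * κ) := by rw [hη, hθ]; field_simp
      calc η⁻¹ * (4 ^ k * κ) ≤ 2 ^ (4 * k) * (4 ^ k * κ) * (4 ^ k * κ) := by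
            rw [h1]; gcongr
        _ = 2 ^ (8 * k + 100 * k ^ 2) := by
            rw [h4, hκ, ← pow_add, ← pow_add, ← pow_add]; ring_nf
        _ ≤ 2 ^ (108 * k ^ 2) := pow_le_pow_right₀ h2 (by omega)
    have hrev := sum_expect_revealed_le (μ := μ) f k δ θ hη0
    have hM' : (2 : ℝ) ^ (34 * k ^ 2) ≤ 2 ^ (108 * k ^ 2) := pow_le_pow_right₀ h2 (by omega)
    have hηc := mul_le_mul_of_nonneg_left hcorr (inv_nonneg.2 hη0.le)
    calc (k : ℝ) * ∑ S ∈ lowSets (Fin n) k,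
          expect μ (Bdd.ind _ (measurableSet_revealed (μ := μ) f k δ θ η S))
        ≤ 2 ^ k * (2 * 2 ^ (108 * k ^ 2)) := by
          gcongr
          · exact Finset.sum_nonneg fun S _ => expect_nonneg (Bdd.ind_nonneg _ _)
          · linarith
      _ ≤ 2 ^ k * (2 ^ k * 2 ^ (108 * k ^ 2)) := by gcongr
      _ = 2 ^ (2 * k + 108 * k ^ 2) := by rw [← pow_add, ← pow_add]; ring_nf
      _ ≤ 2 ^ (110 * k ^ 2) := pow_le_pow_right₀ h2 (by omega)
      _ ≤ Real.exp 1 ^ (110 * k ^ 2) := by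
          gcongr
          linarith [Real.add_one_le_exp 1]
      _ = Real.exp (110 * (k : ℝ) ^ 2) := by
          rw [← Real.exp_nat_mul]; push_cast; ring_nf
      -- The exponent obtained is quadratic, at most `110 * (17 * m) ^ 2`; since `m ≥ 1` it is far
      -- below the cubic one.
      _ ≤ Real.exp (10 ^ 15 * m ^ 3) := by
          refine Real.exp_le_exp.2 ?_
          have h5 : (k : ℝ) ^ 2 ≤ (17 * m) ^ 2 := by gcongr
          have h6 : m ^ 2 ≤ m ^ 3 := pow_le_pow_right₀ hm1 (by norm_num)
          have h7 : 0 ≤ m ^ 2 := sq_nonneg m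
          nlinarith

end Main

end PseudoJunta

theorem theorem2p4 {X : Type*} [MeasurableSpace X] (μ : Measure X) [IsProbabilityMeasure μ]
    (n : ℕ) (f : (Fin n → X) → ℝ) (hf : Measurable f) (hf01 : PseudoJunta.IsBoolean f)
    (ε : ℝ) (hε : 0 < ε) :
    ∃ h : (Fin n → X) → ℝ,
      PseudoJunta.IsPseudoJunta μ
        (Real.exp (10 ^ 15 * ε ^ (-3 : ℤ) * (⌈PseudoJunta.totalInfluence μ f⌉ : ℝ) ^ 3)) h ∧
      eLpNorm (f - h) 1 (Measure.pi fun _ : Fin n => μ) ≤ ENNReal.ofReal ε := by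
  set g : PseudoJunta.Bdd (Fin n) X :=
    ⟨f, hf, 1, fun x => by rcases hf01 x with h | h <;> simp [h]⟩ with hg
  have hg01 : PseudoJunta.IsBoolean (g : (Fin n → X) → ℝ) := hf01
  have hexp : (10 ^ 15 * ε ^ (-3 : ℤ) * (⌈PseudoJunta.totalInfluence μ f⌉ : ℝ) ^ 3)
      = 10 ^ 15 * ((⌈PseudoJunta.totalInfluence μ f⌉ : ℝ) / ε) ^ 3 := by
    rw [div_pow, zpow_neg, div_eq_mul_inv]
    norm_cast
    ring
  rw [hexp]
  -- With `k = 0` there are no low sets: nothing is revealed and `h` is the rounded constant. The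
  -- parameters 1 are placeholders.
  have hconst : ∀ c : ℝ, PseudoJunta.expect μ ((g - c • 1) ^ 2) ≤ ε / 4 →
      ∃ h : (Fin n → X) → ℝ, PseudoJunta.IsPseudoJunta μ
        (Real.exp (10 ^ 15 * ((⌈PseudoJunta.totalInfluence μ f⌉ : ℝ) / ε) ^ 3)) h ∧
        eLpNorm (f - h) 1 (Measure.pi fun _ : Fin n => μ) ≤ ENNReal.ofReal ε := by
    intro c hc
    refine PseudoJunta.exists_pseudoJunta_of_kept hg01 g 0 1 1 1 c ε _ ?_ ?_
    · simpa only [PseudoJunta.lowSets_zero, Finset.sum_empty, add_zero] using hc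
    · simpa using (Real.exp_pos _).le
  rcases le_or_gt 1 ε with hε1 | hε1
  -- Both values of `f` are at distance 1/2 from 1/2, with square `1/4 ≤ ε/4`.
  · refine hconst (1 / 2) ?_
    have : (g - (1 / 2 : ℝ) • 1) ^ 2 = (1 / 4 : ℝ) • (1 : PseudoJunta.Bdd (Fin n) X) := by
      ext x
      rcases hg01 x with h | h <;> simp [h] <;> norm_num
    rw [this, map_smul, PseudoJunta.expect_one, smul_eq_mul]
    linarith
  · have hI0 := PseudoJunta.totalInfluence_nonneg (μ := μ) f
    -- Zero influence is separate because its ceiling is 0, not at least 1; then the variance, which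
    -- is the energy above degree 0, vanishes.
    rcases eq_or_lt_of_le hI0 with hI | hI
    · refine hconst (PseudoJunta.expect μ g) ?_
      have h1 := PseudoJunta.eq_expect_add_low_add_high (μ := μ) g 0
      have h2 := PseudoJunta.mul_expect_sq_high_le (μ := μ) hg01 0
      rw [PseudoJunta.lowSets_zero, Finset.sum_empty, add_zero] at h1
      rw [← sub_eq_of_eq_add' h1] at h2
      have h3 : PseudoJunta.totalInfluence μ (g : (Fin n → X) → ℝ) = 0 := hI.symm
      rw [h3] at h2
      norm_num at h2
      linarith
    · refine PseudoJunta.exists_pseudoJunta_of_lt_one hg01 hε hε1 ?_ (Int.le_ceil _)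
      exact_mod_cast Int.one_le_ceil_iff.2 hI
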